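/- **Setting.** Let $\hat H\in(1/3,1/2]$ and $\eta\in(1/3,\hat H)$. Let $\Omega_2$ be the set of continuous paths $\omega:\mathbb R\to\mathbb R^m$ with $\omega(0)=0$ that are $\eta$-Hölder continuous on every compact interval and satisfy $\|\omega(t)\|/|t|\to0$ as $t\to\pm\infty$, with the trace of the Borel $\sigma$-algebra of the compact-open topology, and let $\mathbb P$ be the law on $\Omega_2$ of the two-sided $m$-dimensional fractional Brownian motion with Hurst index $\hat H$. Let $\theta_t\omega=\omega(\cdot+t)-\omega(t)$ be the Wiener shift. For $\varepsilon>0$ put $\omega_\varepsilon(t)=\omega(t/\varepsilon)$; shifting $\omega_\varepsilon$ by $t$ amounts to replacing $\omega$ by $\theta^\varepsilon_t\omega:=\theta_{t/\varepsilon}\omega$, that is $(\theta^\varepsilon_t\omega)_\varepsilon=\theta_t(\omega_\varepsilon)$, and $\theta^\varepsilon$ is the base flow of all systems with parameter $\varepsilon$. Let $A\in\mathbb R^{m\times m}$ satisfy $\langle Ay,y\rangle\ge\lambda_A\|y\|^2$ for all $y$, and let $\tilde g:\mathbb R^n\times\mathbb R^m\to\mathbb R^m$ satisfy $\|\tilde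 g(x_1,y_1)-\tilde g(x_2,y_2)\|\le C_{\tilde g}(\|x_1-x_2\|+\|y_1-y_2\|)$, where $0<C_{\tilde g}<\lambda_A$. For $\varepsilon>0$ put $$Z^\varepsilon(\omega)=-\frac A\varepsilon\int_{-\infty}^0e^{Ar/\varepsilon}\,\omega_\varepsilon(r)\,dr .$$ For $x\in\mathbb R^n$ let $\tilde\phi^{x,\varepsilon}$ be the solution map of $y'=\varepsilon^{-1}\bigl(-Ay+\tilde g(x,y+Z^\varepsilon(\theta^\varepsilon_t\omega))\bigr)$, $y(0)=y_0$, and let $\phi^{x,\varepsilon}(t,\omega,y_0)=\tilde\phi^{x,\varepsilon}(t,\omega,y_0-Z^\varepsilon(\omega))+Z^\varepsilon(\theta^\varepsilon_t\omega)$. For $0<\mu<\lambda_A-C_{\tilde g}$ let $C^x(\omega)$ be the closed ball with centre $0$ and square radius $$\rho^x(\omega)^2=2\int_{-\infty}^0e^{(\lambda_A-C_{\tilde g}-\mu)r/\varepsilon}\,\frac1{\varepsilon\mu}\Bigl(3C_{\tilde g}^2\|x\|^2+3C_{\tilde g}^2\|Z^\varepsilon(\theta^\varepsilon_r\omega)\|^2+3\max(1,C_{\tilde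 g})^2\|\tilde g(0,0)\|^2\Bigr)dr .$$ A random variable $X\ge0$ is tempered if $\log^+X(\theta^\varepsilon_t\omega)/|t|\to0$ as $t\to\pm\infty$ for every $\omega\in\Omega_2$. A tempered random set is a family $(D(\omega))_{\omega\in\Omega_2}$ of nonempty closed bounded sets such that $\omega\mapsto\mathrm{dist}(y,D(\omega))$ is measurable for every $y$ and $\omega\mapsto\sup_{y\in D(\omega)}\|y\|$ is tempered. A random fixed point of an RDS $\psi$ over $\theta^\varepsilon$ is a random variable $Y$ with $\psi(t,\omega,Y(\omega))=Y(\theta^\varepsilon_t\omega)$ for all $t\ge0$ and $\omega\in\Omega_2$. **Statement.** For all $\varepsilon>0$, $x\in\mathbb R^n$ and $0<\mu<\lambda_A-C_{\tilde g}$ the following hold. 1. The integral defining $Z^\varepsilon$ converges for every $\omega\in\Omega_2$, $Z^\varepsilon$ is measurable, $t\mapsto Z^\varepsilon(\theta^\varepsilon_t\omega)$ is a continuous stationary solution of $dZ=-\varepsilon^{-1}AZ\,dt+d\omega_\varepsilon$ on $\mathbb R$, and $Z^\varepsilon(\theta^\varepsilon_t\omega)=Z^1(\theta_{t/\varepsilon}\omega)$.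 2. For all $\omega\in\Omega_2$ and $y_0\in\mathbb R^m$ the equation for $\tilde\phi^{x,\varepsilon}$ has a unique solution on $[0,\infty)$; $t\mapsto\phi^{x,\varepsilon}(t,\omega,y_0)$ is the unique continuous solution on $[0,\infty)$ of $dy=\varepsilon^{-1}(-Ay+\tilde g(x,y))dt+d\omega_\varepsilon$, $y(0)=y_0$. Both $\tilde\phi^{x,\varepsilon}$ and $\phi^{x,\varepsilon}$ are measurable random dynamical systems over the measure preserving measurable flow $(\Omega_2,\mathbb P,\theta^\varepsilon)$, and both satisfy, for all $t\ge0$, $\omega\in\Omega_2$ and $y_1,y_2\in\mathbb R^m$, $$\|\psi(t,\omega,y_1)-\psi(t,\omega,y_2)\|\le e^{-(\lambda_A-C_{\tilde g})t/\varepsilon}\|y_1-y_2\| .$$ 3. The integral defining $\rho^x(\omega)^2$ converges and its value does not depend on $\varepsilon$. The balls $C^x(\omega)$ form a tempered random set that is forward invariant: $\tilde\phi^{x,\varepsilon}(t,\omega,C^x(\omega))\subset C^x(\theta^\varepsilon_t\omega)$ for $t\ge0$. Likewise the balls $C^x(\omega)+Z^\varepsilon(\omega)$ form a tempered random set that is forward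 invariant under $\phi^{x,\varepsilon}$. 4. $\tilde\phi^{x,\varepsilon}$ has a random fixed point $\tilde Y_F^\varepsilon(\cdot,x)$ with $\tilde Y_F^\varepsilon(\omega,x)\in C^x(\omega)$ for all $\omega$, which does not depend on $\mu$, and $Y_F^\varepsilon(\omega,x)=\tilde Y_F^\varepsilon(\omega,x)+Z^\varepsilon(\omega)\in C^x(\omega)+Z^\varepsilon(\omega)$ is a random fixed point of $\phi^{x,\varepsilon}$. Each is the only random fixed point of its RDS in the respective ball (for every $\omega$), each is $\mathbb P$-almost surely the only random fixed point in $\mathbb R^m$, and their norms are tempered. Each attracts in the pullback and in the forward sense with every exponential speed $\alpha<(\lambda_A-C_{\tilde g})/\varepsilon$: if $D$ is a tempered random set (for instance the respective ball) and $y$ is a measurable selector of $D$, then for every $\omega\in\Omega_2$ $$e^{\alpha t}\|\psi(t,\theta^\varepsilon_{-t}\omega,y(\theta^\varepsilon_{-t}\omega))-Y(\omega)\|\to0,\qquad e^{\alpha t}\|\psi(t,\omega,y(\omega))-Y(\theta^\varepsilon_t\omega)\|\to0\qquad(t\to\infty),$$ where $(\psi,Y)$ is $(\tilde\phi^{x,\varepsilon},\tilde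 Y^\varepsilon_F(\cdot,x))$ or $(\phi^{x,\varepsilon},Y^\varepsilon_F(\cdot,x))$. 5. $\tilde Y^\varepsilon_F(\theta^\varepsilon_t\omega,x)=\tilde Y^1_F(\theta_{t/\varepsilon}\omega,x)$ and $Y^\varepsilon_F(\theta^\varepsilon_t\omega,x)=Y^1_F(\theta_{t/\varepsilon}\omega,x)$ for all $t\in\mathbb R$ and $\omega\in\Omega_2$. 6. For all $x_1,x_2\in\mathbb R^n$ and $\omega\in\Omega_2$, $\|\tilde Y^\varepsilon_F(\omega,x_1)-\tilde Y^\varepsilon_F(\omega,x_2)\|\le\frac{C_{\tilde g}}{\lambda_A-C_{\tilde g}}\|x_1-x_2\|$, and the same holds for $Y^\varepsilon_F$. -/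

import Mathlib

open MeasureTheory ProbabilityTheory Filter Topology Set
open scoped NNReal

namespace FastSlow

/-- Euclidean space `ℝ^d` with its Euclidean norm. -/
abbrev Vec (d : ℕ) : Type := EuclideanSpace ℝ (Fin d)

/-! ### The path space of the fractional Brownian motion -/

section PathSpaceSection

/-- The Borel σ-algebra of the compact-open topology. -/
instance instMeasurableSpaceContinuousMap (m : ℕ) : MeasurableSpace C(ℝ, Vec m) := borel _

instance instBorelSpaceContinuousMap (m : ℕ) : BorelSpace C(ℝ, Vec m) := ⟨rfl⟩

/-- Continuous paths on `ℝ` that vanish at `0`, are `η`-Hölder continuous on every compact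
interval and grow sublinearly at `±∞`; as a subtype it carries the trace of the Borel
σ-algebra. -/
abbrev PathSpace (m : ℕ) (η : ℝ) : Type :=
  {ω : C(ℝ, Vec m) // ω 0 = 0 ∧
    (∀ T₁ T₂ : ℝ, T₁ < T₂ → ∃ K : ℝ, ∀ s ∈ Icc T₁ T₂, ∀ t ∈ Icc T₁ T₂,
      ‖ω t - ω s‖ ≤ K * |t - s| ^ η) ∧
    (fun t : ℝ => ω t) =o[cocompact ℝ] (fun t : ℝ => t)}

/-- The Wiener shift `θ_t ω = ω (· + t) - ω t`. -/
def shift {m : ℕ} {η : ℝ} (t : ℝ) (ω : PathSpace m η) : PathSpace m η :=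
  ⟨⟨fun s => ω.1 (s + t) - ω.1 t, by fun_prop⟩, by
    obtain ⟨ω, h0, hH, hG⟩ := ω
    refine ⟨by simp, ?_, ?_⟩
    · intro T₁ T₂ hT
      obtain ⟨K, hK⟩ := hH (T₁ + t) (T₂ + t) (by linarith)
      refine ⟨K, fun s hs r hr => ?_⟩
      have := hK (s + t) ⟨by linarith [hs.1], by linarith [hs.2]⟩ (r + t)
        ⟨by linarith [hr.1], by linarith [hr.2]⟩
      simpa using this
    · have hid : Tendsto (fun s : ℝ => ‖s‖) (cocompact ℝ) atTop := tendsto_norm_cocompact_atTop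
      have hc : ∀ {F : Type} [NormedAddCommGroup F] (c : F),
          (fun _ : ℝ => c) =o[cocompact ℝ] (fun s : ℝ => s) := by
        intro F _ c
        exact Asymptotics.isLittleO_const_left.2 (Or.inr hid)
      have htr : Tendsto (fun s : ℝ => s + t) (cocompact ℝ) (cocompact ℝ) :=
        (Homeomorph.addRight t).isClosedEmbedding.tendsto_cocompact
      have h1 : (fun s : ℝ => ω (s + t)) =o[cocompact ℝ] (fun s : ℝ => s + t) :=
        hG.comp_tendsto htr
      have h2 : (fun s : ℝ => s + t) =O[cocompact ℝ] (fun s : ℝ => s) :=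
        (Asymptotics.isBigO_refl _ _).add (hc t).isBigO
      exact (h1.trans_isBigO h2).sub (hc (ω t))⟩

/-- The law of the two-sided `m`-dimensional fractional Brownian motion with Hurst index `H`:
the canonical process is centred Gaussian with covariance
`(|s|^{2H} + |t|^{2H} - |t - s|^{2H}) / 2 · Id`. -/
structure IsFBMLaw {m : ℕ} {η : ℝ} (H : ℝ) (P : Measure (PathSpace m η)) : Prop where
  gaussian : IsGaussianProcess (fun (t : ℝ) (ω : PathSpace m η) => ω.1 t) P
  mean : ∀ t : ℝ, ∫ ω, ω.1 t ∂P = 0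
  cov : ∀ (s t : ℝ) (i j : Fin m),
    covariance (fun ω : PathSpace m η => ω.1 s i) (fun ω : PathSpace m η => ω.1 t j) P
      = if i = j then (|s| ^ (2 * H) + |t| ^ (2 * H) - |t - s| ^ (2 * H)) / 2 else 0

/-- The time-scaled driving path `ω_ε (t) = ω (t / ε)`. -/
noncomputable def driver {m : ℕ} {η : ℝ} (ε : ℝ) (ω : PathSpace m η) (t : ℝ) : Vec m := ω.1 (t / ε)

/-- The action on `ω` of the Wiener shift by `t` of the driving path `ω_ε`; see
`driver_shiftEps`. -/
noncomputable def shiftEps {m : ℕ} {η : ℝ} (ε : ℝ) (t : ℝ) (ω : PathSpace m η) : PathSpace m η :=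
  shift (t / ε) ω

theorem driver_shiftEps {m : ℕ} {η : ℝ} (ε t s : ℝ) (ω : PathSpace m η) :
    driver ε (shiftEps ε t ω) s = driver ε ω (s + t) - driver ε ω t := by
  simp [driver, shiftEps, shift, add_div]

end PathSpaceSection

/-! ### Random dynamical systems -/

section RDS

variable {Ω B : Type*} [MeasurableSpace Ω] [NormedAddCommGroup B] [MeasurableSpace B]

/-- A measurable, measure preserving flow on a probability space. -/
structure IsMetricDS (θ : ℝ → Ω → Ω) (P : Measure Ω) : Prop where
  prob : IsProbabilityMeasure P
  measurable : Measurable (fun p : ℝ × Ω => θ p.1 p.2)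
  zero : ∀ ω, θ 0 ω = ω
  add : ∀ s t ω, θ (t + s) ω = θ t (θ s ω)
  preserving : ∀ t, MeasurePreserving (θ t) P P

/-- `φ` is a (measurable) random dynamical system over the metric dynamical system `(P, θ)`. -/
structure IsRDS (θ : ℝ → Ω → Ω) (P : Measure Ω) (φ : ℝ≥0 → Ω → B → B) : Prop where
  base : IsMetricDS θ P
  measurable : Measurable (fun p : ℝ≥0 × Ω × B => φ p.1 p.2.1 p.2.2)
  zero : ∀ ω y, φ 0 ω y = y
  cocycle : ∀ (t τ : ℝ≥0) ω y, φ (t + τ) ω y = φ t (θ τ ω) (φ τ ω y)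

/-- A nonnegative random variable `X` is tempered if `log⁺ X(θ_t ω) / |t| → 0` as `t → ±∞`. -/
structure IsTempered (θ : ℝ → Ω → Ω) (X : Ω → ℝ) : Prop where
  measurable : Measurable X
  nonneg : ∀ ω, 0 ≤ X ω
  limit : ∀ ω, Tendsto (fun t : ℝ => Real.posLog (X (θ t ω)) / |t|) (cocompact ℝ) (𝓝 0)

/-- A tempered random set: nonempty closed bounded fibres, measurable distance functions, and
tempered supremum of the norm. -/
structure IsTemperedRandomSet (θ : ℝ → Ω → Ω) (C : Ω → Set B) : Prop where
  nonempty : ∀ ω, (C ω).Nonempty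
  closed : ∀ ω, IsClosed (C ω)
  measurable : ∀ y, Measurable (fun ω => Metric.infDist y (C ω))
  bounded : ∀ ω, Bornology.IsBounded (C ω)
  tempered : IsTempered θ (fun ω => sSup ((fun y => ‖y‖) '' C ω))

/-- Forward invariance: `φ(t, ω, C(ω)) ⊆ C(θ_t ω)` for `t ≥ 0`. -/
def IsForwardInvariant (θ : ℝ → Ω → Ω) (φ : ℝ≥0 → Ω → B → B) (C : Ω → Set B) : Prop :=
  ∀ (t : ℝ≥0) ω, φ t ω '' C ω ⊆ C (θ t ω)

/-- A random variable `Y` with `φ(t, ω, Y(ω)) = Y(θ_t ω)` for all `t ≥ 0` and all `ω`. -/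
structure IsRandomFixedPoint (θ : ℝ → Ω → Ω) (φ : ℝ≥0 → Ω → B → B) (Y : Ω → B) : Prop where
  measurable : Measurable Y
  fixed : ∀ (t : ℝ≥0) ω, φ t ω (Y ω) = Y (θ t ω)

/-- `Y` attracts every measurable selector of `D`, in the pullback and in the forward sense,
with every exponential speed `α < κ`. -/
def AttractsSelectors (θ : ℝ → Ω → Ω) (φ : ℝ≥0 → Ω → B → B) (κ : ℝ) (D : Ω → Set B)
    (Y : Ω → B) : Prop :=
  ∀ y : Ω → B, Measurable y → (∀ ω, y ω ∈ D ω) → ∀ ω, ∀ α < κ,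
    Tendsto (fun t : ℝ≥0 =>
      Real.exp (α * t) * ‖φ t (θ (-t) ω) (y (θ (-t) ω)) - Y ω‖) atTop (𝓝 0) ∧
    Tendsto (fun t : ℝ≥0 =>
      Real.exp (α * t) * ‖φ t ω (y ω) - Y (θ t ω)‖) atTop (𝓝 0)

/-- The conclusions on one cocycle `φ`, one forward invariant set `C` and one fixed point `Y`:
`C` is a forward invariant tempered random set, `Y` is a random fixed point in `C`,
unique among the random fixed points in `C`, almost surely unique among all random fixed
points in `B`, of tempered norm, and it attracts the measurable selectors of every tempered
random set (in particular those of `C`) with every exponential speed below `κ`. -/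
structure IsAttractingFixedPointIn (θ : ℝ → Ω → Ω) (P : Measure Ω) (φ : ℝ≥0 → Ω → B → B)
    (κ : ℝ) (C : Ω → Set B) (Y : Ω → B) : Prop where
  temperedSet : IsTemperedRandomSet θ C
  forwardInvariant : IsForwardInvariant θ φ C
  isFixed : IsRandomFixedPoint θ φ Y
  mem : ∀ ω, Y ω ∈ C ω
  unique : ∀ Y' : Ω → B, IsRandomFixedPoint θ φ Y' → (∀ ω, Y' ω ∈ C ω) → Y' = Y
  unique_ae : ∀ Y' : Ω → B, IsRandomFixedPoint θ φ Y' → Y' =ᵐ[P] Y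
  tempered : IsTempered θ (fun ω => ‖Y ω‖)
  attracts : ∀ D : Ω → Set B, IsTemperedRandomSet θ D → AttractsSelectors θ φ κ D Y

end RDS

/-! ### The frozen fast equation -/

section FastEquation

variable {m n : ℕ} {η : ℝ}

/-- The integrand `e^{A r / ε} ω_ε(r)` of the Ornstein-Uhlenbeck variable. -/
noncomputable def ouIntegrand (A : Vec m →L[ℝ] Vec m) (ε : ℝ) (ω : PathSpace m η) (r : ℝ) :
    Vec m :=
  NormedSpace.exp ((r / ε) • A) (driver ε ω r)

/-- `Z^ε(ω) = -(A/ε) ∫_{-∞}^0 e^{A r / ε} ω_ε(r) dr`. -/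
noncomputable def ou (A : Vec m →L[ℝ] Vec m) (ε : ℝ) (ω : PathSpace m η) : Vec m :=
  -((1 / ε) • A (∫ r in Iic (0 : ℝ), ouIntegrand A ε ω r))

/-- `u` solves `dy = ε⁻¹ (-A y + g(x, y)) dt + dω_ε`, `y(0) = y₀`, on `[0, ∞)`. -/
def IsFastSolution (A : Vec m →L[ℝ] Vec m) (g : Vec n → Vec m → Vec m) (ε : ℝ) (x : Vec n)
    (ω : PathSpace m η) (y₀ : Vec m) (u : ℝ → Vec m) : Prop :=
  ContinuousOn u (Ici 0) ∧
    ∀ t : ℝ, 0 ≤ t →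
      u t = y₀ + (1 / ε) • (∫ r in (0 : ℝ)..t, (-A (u r) + g x (u r))) + driver ε ω t

/-- `u` solves the random differential equation
`y' = ε⁻¹ (-A y + g(x, y + Z^ε(θ_t ω)))`, `y(0) = y₀`, on `[0, ∞)`. -/
def IsTransformedSolution (A : Vec m →L[ℝ] Vec m) (g : Vec n → Vec m → Vec m) (ε : ℝ)
    (x : Vec n) (ω : PathSpace m η) (y₀ : Vec m) (u : ℝ → Vec m) : Prop :=
  u 0 = y₀ ∧
    ∀ t : ℝ, 0 ≤ t →
      HasDerivWithinAt u ((1 / ε) • (-A (u t) + g x (u t + ou A ε (shiftEps ε t ω))))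
        (Ici 0) t

open Classical in
/-- The solution map of the random differential equation (the value `y₀` is a
placeholder for the case that there is no solution). -/
noncomputable def phiTilde (A : Vec m →L[ℝ] Vec m) (g : Vec n → Vec m → Vec m) (ε : ℝ)
    (x : Vec n) (t : ℝ≥0) (ω : PathSpace m η) (y₀ : Vec m) : Vec m :=
  if h : ∃ u : ℝ → Vec m, IsTransformedSolution A g ε x ω y₀ u then h.choose t else y₀

/-- The conjugation `T^ε(ω, y) = y + Z^ε(ω)`. -/
noncomputable def conj (A : Vec m →L[ℝ] Vec m) (ε : ℝ) (ω : PathSpace m η) (y : Vec m) :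
    Vec m :=
  y + ou A ε ω

/-- The inverse `(T^ε)⁻¹(ω, y) = y - Z^ε(ω)`. -/
noncomputable def conjInv (A : Vec m →L[ℝ] Vec m) (ε : ℝ) (ω : PathSpace m η) (y : Vec m) :
    Vec m :=
  y - ou A ε ω

/-- The conjugated cocycle `φ(t, ω, y₀) = T^ε(θ_t ω, φ̃(t, ω, (T^ε)⁻¹(ω, y₀)))`. -/
noncomputable def phi (A : Vec m →L[ℝ] Vec m) (g : Vec n → Vec m → Vec m) (ε : ℝ)
    (x : Vec n) (t : ℝ≥0) (ω : PathSpace m η) (y₀ : Vec m) : Vec m :=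
  conj A ε (shiftEps ε t ω) (phiTilde A g ε x t ω (conjInv A ε ω y₀))

/-- The integrand of the square radius. -/
noncomputable def radiusIntegrand (A : Vec m →L[ℝ] Vec m) (g : Vec n → Vec m → Vec m)
    (lam L μ ε : ℝ) (x : Vec n) (ω : PathSpace m η) (r : ℝ) : ℝ :=
  Real.exp ((lam - L - μ) * r / ε) * (1 / (ε * μ)) *
    (3 * L ^ 2 * ‖x‖ ^ 2 + 3 * L ^ 2 * ‖ou A ε (shiftEps ε r ω)‖ ^ 2
      + 3 * (max 1 L) ^ 2 * ‖g 0 0‖ ^ 2)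

/-- The square radius `ρ^x(ω)²` of the ball. -/
noncomputable def radiusSq (A : Vec m →L[ℝ] Vec m) (g : Vec n → Vec m → Vec m)
    (lam L μ ε : ℝ) (x : Vec n) (ω : PathSpace m η) : ℝ :=
  2 * ∫ r in Iic (0 : ℝ), radiusIntegrand A g lam L μ ε x ω r

/-- The closed ball `C^x(ω)` with centre `0` and square radius `ρ^x(ω)²`. -/
noncomputable def ballC (A : Vec m →L[ℝ] Vec m) (g : Vec n → Vec m → Vec m)
    (lam L μ ε : ℝ) (x : Vec n) (ω : PathSpace m η) : Set (Vec m) :=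
  Metric.closedBall 0 (Real.sqrt (radiusSq A g lam L μ ε x ω))

/-- The closed ball with centre `Z^ε(ω)` and square radius `ρ^x(ω)²`. -/
noncomputable def ballCZ (A : Vec m →L[ℝ] Vec m) (g : Vec n → Vec m → Vec m)
    (lam L μ ε : ℝ) (x : Vec n) (ω : PathSpace m η) : Set (Vec m) :=
  Metric.closedBall (ou A ε ω) (Real.sqrt (radiusSq A g lam L μ ε x ω))

end FastEquation

end FastSlow

/-! Everything is pathwise. With `Z` the Ornstein-Uhlenbeck variable, subtracting `Z` along the
orbit turns the equation driven by the rough path into an ordinary differential equation. Its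
right-hand side is continuous in time and globally Lipschitz in the state. This works because the
driving path minus `Z` along the orbit equals `A` applied to a history integral, which is
differentiable (`hasDerivAt_ou_history`).

The parameter `ε` is only a change of clock. The substitution `r ↦ r / ε` shows that `Z` and the
radius, as functions of the path, do not depend on `ε` (`ou_eq_one`, `radiusSq_eq_one`), and the
solution map at time `t` is the unscaled one at time `t / ε` (`phiTilde_eq_one`). Hence one fixed
point, built for `ε = 1`, serves every `ε`.

Coercivity of `A` beats the Lipschitz constant of `g`, so solutions contract at rate `κ = (lam - L)
/ ε` (`inner_fastField_sub_le`, `IsForwardSolution.norm_sub_le`). The square radius solves a linear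
equation that majorises the squared norm of a solution, which makes the balls invariant
(`two_inner_fastField_le`, `exp_mul_radiusSq_shift`). Linear growth of the path gives linear growth
of `Z` and of the radius along orbits, hence temperedness. Contraction together with a tempered
bound makes the solutions started at `0` in the remote past converge
(`exists_randomFixedPoint_of_contraction`), and their limit is the fixed point. Attraction and
uniqueness in the ball follow from the same contraction. Almost sure uniqueness uses invariance of
the measure instead of temperedness. Lipschitz dependence on `x` is proved for the approximating
solutions and passes to the limit.

For the probabilistic side, evaluations generate the Borel σ-algebra of the path space, so the law
is fixed by its finite-dimensional distributions. These are Gaussian with stationary increments,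
hence invariant under the shift. Measurability of the solution map comes from Picard iteration and
continuity in time and state. -/

namespace FastSlow

/-! ### Borel sets of the compact-open topology and evaluations -/

section PathMeasurability

variable {E : Type*} [PseudoMetricSpace E] [MeasurableSpace E]
  [BorelSpace E]

/-- A compact set is mapped into an open set iff, for some margin, the points of a countable dense
subset keep that distance from the complement. -/
theorem measurableSet_mapsTo_of_eval {Ω : Type*} [MeasurableSpace Ω] {F : Ω → C(ℝ, E)}
    (hF : ∀ t, Measurable fun ω => F ω t) {K : Set ℝ} (hK : IsCompact K) {U : Set E}
    (hU : IsOpen U) : MeasurableSet {ω | MapsTo (F ω) K U} := by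
  obtain ⟨D, hDc, hDd⟩ := TopologicalSpace.exists_countable_dense K
  -- The extended distance is infinite when `U` is the whole space, so that case needs no separate
  -- treatment.
  have key : {ω | MapsTo (F ω) K U} =
      ⋃ n : ℕ, ⋂ x ∈ D, {ω | ((n : ENNReal) + 1)⁻¹ ≤ Metric.infEDist (F ω (x : K).1) Uᶜ} := by
    ext ω
    simp only [mem_ofPred_eq, mem_iUnion, mem_iInter]
    have hcont : Continuous fun x : ℝ => Metric.infEDist (F ω x) Uᶜ :=
      Metric.continuous_infEDist.comp (F ω).continuous
    constructor
    · intro h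
      rcases K.eq_empty_or_nonempty with rfl | hne
      · exact ⟨0, fun x => x.2.elim⟩
      · obtain ⟨x₀, hx₀, hmin⟩ := hK.exists_isMinOn hne hcont.continuousOn
        have hpos : Metric.infEDist (F ω x₀) Uᶜ ≠ 0 := by
          intro h0
          have := (Metric.mem_closure_iff_infEDist_zero).2 h0
          rw [hU.isClosed_compl.closure_eq] at this
          exact this (h hx₀)
        obtain ⟨n, hn⟩ := ENNReal.exists_inv_nat_lt hpos
        refine ⟨n, fun x _ => ?_⟩
        calc ((n : ENNReal) + 1)⁻¹ ≤ (n : ENNReal)⁻¹ := ENNReal.inv_le_inv.2 le_self_add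
          _ ≤ _ := hn.le
          _ ≤ _ := hmin x.2
    -- The margin passes from the dense set to all of `K` because the points that keep it form a
    -- closed set.
    · rintro ⟨n, hn⟩ x hx
      have hcl : IsClosed {x : K | ((n : ENNReal) + 1)⁻¹ ≤ Metric.infEDist (F ω x.1) Uᶜ} :=
        isClosed_le continuous_const (hcont.comp continuous_subtype_val)
      have hall : (⟨x, hx⟩ : K) ∈ {x : K | ((n : ENNReal) + 1)⁻¹ ≤ Metric.infEDist (F ω x.1) Uᶜ} :=
        hcl.closure_subset_iff.2 (fun y hy => hn y hy) (hDd.closure_eq ▸ mem_univ _)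
      by_contra hxU
      have h0 : Metric.infEDist (F ω x) Uᶜ = 0 := Metric.infEDist_zero_of_mem hxU
      simp only [mem_ofPred_eq, h0, nonpos_iff_eq_zero, ENNReal.inv_eq_zero] at hall
      exact absurd hall (by finiteness)
  rw [key]
  exact MeasurableSet.iUnion fun n => MeasurableSet.biInter hDc fun x _ =>
    measurableSet_le measurable_const (measurable_infEDist.comp (hF x))

/-- The Borel σ-algebra of the compact-open topology is generated by the evaluations. -/
theorem measurable_continuousMap_of_eval [SecondCountableTopology E] [MeasurableSpace C(ℝ, E)]
    [BorelSpace C(ℝ, E)] {Ω : Type*} [MeasurableSpace Ω] {F : Ω → C(ℝ, E)}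
    (hF : ∀ t, Measurable fun ω => F ω t) : Measurable F := by
  have hb := borel_eq_generateFrom_of_subbasis (α := C(ℝ, E))
    ContinuousMap.compactOpen_eq
  rw [← BorelSpace.measurable_eq (α := C(ℝ, E))] at hb
  rw [hb]
  refine measurable_generateFrom ?_
  rintro _ ⟨K, hK, U, hU, rfl⟩
  exact measurableSet_mapsTo_of_eval hF hK hU

end PathMeasurability

/-! ### The Wiener shift as a measure preserving flow -/

section MetricDS

variable {m : ℕ} {η : ℝ}

theorem measurable_eval (t : ℝ) : Measurable fun ω : PathSpace m η => ω.1 t :=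
  (continuous_eval_const t).measurable.comp measurable_subtype_coe

theorem measurable_pathSpace_of_eval {Ω : Type*} [MeasurableSpace Ω] {F : Ω → PathSpace m η}
    (hF : ∀ t, Measurable fun ω => (F ω).1 t) : Measurable F :=
  (measurable_continuousMap_of_eval hF).subtype_mk (h := fun ω => (F ω).2)

theorem measurable_uncurry_eval :
    Measurable fun p : ℝ × PathSpace m η => p.2.1 p.1 :=
  measurable_uncurry_of_continuous_of_measurable (u := fun (t : ℝ) (ω : PathSpace m η) => ω.1 t)
    (fun ω => ω.1.continuous) measurable_eval

theorem measurable_uncurry_shift :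
    Measurable fun p : ℝ × PathSpace m η => shift p.1 p.2 := by
  refine measurable_pathSpace_of_eval fun s => ?_
  have h1 : Measurable fun p : ℝ × PathSpace m η => p.2.1 (s + p.1) :=
    measurable_uncurry_eval.comp ((measurable_fst.const_add s).prodMk measurable_snd)
  exact h1.sub measurable_uncurry_eval

theorem pathSpace_ext {ω₁ ω₂ : PathSpace m η} (h : ∀ s, ω₁.1 s = ω₂.1 s) : ω₁ = ω₂ :=
  Subtype.ext (ContinuousMap.ext h)

theorem shift_apply (t s : ℝ) (ω : PathSpace m η) :
    (shift t ω).1 s = ω.1 (s + t) - ω.1 t := rfl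

theorem shift_zero (ω : PathSpace m η) : shift 0 ω = ω :=
  pathSpace_ext fun s => by simp [shift_apply, ω.2.1]

theorem shift_shift (s t : ℝ) (ω : PathSpace m η) : shift t (shift s ω) = shift (t + s) ω :=
  pathSpace_ext fun r => by simp [shift_apply, add_assoc]

/-- Two measures on the path space with the same finite-dimensional distributions agree. -/
theorem pathSpace_measure_ext {P Q : Measure (PathSpace m η)}
    (h : P.map (fun ω t => ω.1 t) = Q.map (fun ω t => ω.1 t)) : P = Q := by
  have hm : Measurable (fun (ω : PathSpace m η) (t : ℝ) => ω.1 t) :=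
    measurable_pi_lambda _ measurable_eval
  have hle : (inferInstance : MeasurableSpace (PathSpace m η)) ≤
      MeasurableSpace.comap (fun (ω : PathSpace m η) (t : ℝ) => ω.1 t) MeasurableSpace.pi := by
    -- The identity out of the σ-algebra pulled back along the evaluations is measurable, because
    -- each evaluation is; this is the inclusion sought.
    have := @measurable_pathSpace_of_eval m η (PathSpace m η)
      (MeasurableSpace.comap (fun (ω : PathSpace m η) (t : ℝ) => ω.1 t) MeasurableSpace.pi) id
      (fun t => (measurable_pi_apply t).comp (comap_measurable _))
    simpa using this.comap_le
  ext S hS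
  obtain ⟨B, hB, rfl⟩ := hle S hS
  rw [← Measure.map_apply hm hB, h, Measure.map_apply hm hB]

variable {H : ℝ} {P : Measure (PathSpace m η)}

theorem IsFBMLaw.memLp (hP : IsFBMLaw H P) (t : ℝ) :
    MemLp (fun ω : PathSpace m η => ω.1 t) 2 P :=
  (hP.gaussian.hasGaussianLaw_eval t).memLp_two

theorem IsFBMLaw.memLp_coord (hP : IsFBMLaw H P) (t : ℝ) (i : Fin m) :
    MemLp (fun ω : PathSpace m η => ω.1 t i) 2 P :=
  (EuclideanSpace.proj (𝕜 := ℝ) i).comp_memLp' (hP.memLp t)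

/-- The increments of the fractional Brownian motion are stationary. -/
theorem IsFBMLaw.covariance_shift [IsProbabilityMeasure P] (hH : 0 < H) (hP : IsFBMLaw H P)
    (t s r : ℝ) (i j : Fin m) :
    covariance (fun ω => (shift t ω).1 s i) (fun ω => (shift t ω).1 r j) P =
      covariance (fun ω : PathSpace m η => ω.1 s i) (fun ω => ω.1 r j) P := by
  have h1 : (fun ω : PathSpace m η => (shift t ω).1 s i) =
      fun ω => ω.1 (s + t) i - ω.1 t i := rfl
  have h2 : (fun ω : PathSpace m η => (shift t ω).1 r j) =
      fun ω => ω.1 (r + t) j - ω.1 t j := rfl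
  rw [h1, h2, covariance_fun_sub_left (hP.memLp_coord _ i) (hP.memLp_coord _ i)
      
      (show MemLp (fun ω : PathSpace m η => ω.1 (r + t) j - ω.1 t j) 2 P from
        (hP.memLp_coord _ j).sub (hP.memLp_coord _ j)),
    covariance_fun_sub_right (hP.memLp_coord _ i) (hP.memLp_coord _ j) (hP.memLp_coord _ j),
    covariance_fun_sub_right (hP.memLp_coord _ i) (hP.memLp_coord _ j) (hP.memLp_coord _ j)]
  simp only [hP.cov]
  split_ifs
  -- The variance at time `t` contains `|t - t| ^ (2 * H)`, which vanishes only because `0 < H`.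
  · have h0 : (0 : ℝ) ^ (2 * H) = 0 := Real.zero_rpow (by positivity)
    have e1 : r + t - (s + t) = r - s := by ring
    have e2 : |t - (s + t)| = |s| := by rw [show t - (s + t) = -s by ring, abs_neg]
    have e3 : r + t - t = r := by ring
    rw [e1, e2, e3, sub_self, abs_zero, h0]
    ring
  · simp

theorem IsFBMLaw.integral_coord (hP : IsFBMLaw H P) [IsProbabilityMeasure P] (t : ℝ) (i : Fin m) :
    ∫ ω, ω.1 t i ∂P = 0 := by
  have := (EuclideanSpace.proj (𝕜 := ℝ) i).integral_comp_comm
    ((hP.memLp t).integrable (by norm_num))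
  rw [hP.mean t] at this
  simpa using this

/-- Reduces the mean and variance of an arbitrary functional of finitely many path values to means
and covariances of single coordinates. -/
theorem dual_pi_vec_apply {I : Type*} [Fintype I] [DecidableEq I]
    (ℓ : StrongDual ℝ (I → Vec m)) (x : I → Vec m) :
    ℓ x = ∑ p : I × Fin m,
      ℓ (Pi.single p.1 (EuclideanSpace.single p.2 1)) * x p.1 p.2 := by
  have hx : x = ∑ p : I × Fin m, x p.1 p.2 •
      (Pi.single p.1 (EuclideanSpace.single p.2 (1 : ℝ)) : I → Vec m) := by
    rw [Fintype.sum_prod_type]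
    ext a b
    simp only [Finset.sum_apply, Pi.smul_apply, WithLp.ofLp_sum, WithLp.ofLp_smul,
      Pi.single_apply, smul_eq_mul]
    rw [Finset.sum_eq_single a, Finset.sum_eq_single b]
    · simp
    · intro c _ hc; simp [Ne.symm hc]
    · simp
    · intro c _ hc
      simp [Ne.symm hc]
    · simp
  conv_lhs => rw [hx]
  simp [mul_comm]

/-- A Gaussian vector is determined by the mean and variance of its linear functionals. The
increments are again Gaussian and centred with the same covariance, so all finite-dimensional
distributions agree. -/
theorem IsFBMLaw.map_shift (hH : 0 < H) [IsProbabilityMeasure P] (hP : IsFBMLaw H P) (t : ℝ) :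
    P.map (shift t) = P := by
  have hmeas : Measurable (shift t : PathSpace m η → PathSpace m η) :=
    measurable_uncurry_shift.comp (measurable_const.prodMk measurable_id)
  refine pathSpace_measure_ext ?_
  rw [Measure.map_map (measurable_pi_lambda _ measurable_eval) hmeas]
  have hG : IsGaussianProcess (fun (s : ℝ) (ω : PathSpace m η) => (shift t ω).1 s) P := by
    have := hP.gaussian.shift t
    simpa only [shift_apply, add_comm] using this
  refine (map_eq_iff_forall_finset_map_restrict_eq
    (X := fun (s : ℝ) (ω : PathSpace m η) => (shift t ω).1 s)
    (Y := fun (s : ℝ) (ω : PathSpace m η) => ω.1 s)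
    (measurable_pi_lambda _ fun s => (measurable_eval s).comp hmeas).aemeasurable
    (measurable_pi_lambda _ measurable_eval).aemeasurable).2 fun I => ?_
  have hmI : Measurable fun ω : PathSpace m η => I.restrict (fun s => ω.1 s) :=
    measurable_pi_lambda _ fun s => measurable_eval s.1
  have : IsProbabilityMeasure (P.map fun ω : PathSpace m η => I.restrict (fun s => ω.1 s)) :=
    Measure.isProbabilityMeasure_map hmI.aemeasurable
  have : IsProbabilityMeasure
      (P.map fun ω : PathSpace m η => I.restrict (fun s => (shift t ω).1 s)) :=
    Measure.isProbabilityMeasure_map (hmI.comp hmeas).aemeasurable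
  refine Measure.ext_of_charFunDual ?_
  ext ℓ
  classical
  rw [(hG.hasGaussianLaw I).charFunDual_map_eq_fun,
    (hP.gaussian.hasGaussianLaw I).charFunDual_map_eq_fun]
  have hL2 : ∀ p : I × Fin m, MemLp (fun ω : PathSpace m η =>
      ℓ (Pi.single p.1 (EuclideanSpace.single p.2 1)) * ω.1 p.1 p.2) 2 P :=
    fun p => (hP.memLp_coord _ _).const_mul _
  have hL2' : ∀ p : I × Fin m, MemLp (fun ω : PathSpace m η =>
      ℓ (Pi.single p.1 (EuclideanSpace.single p.2 1)) * (shift t ω).1 p.1 p.2) 2 P :=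
    fun p => ((hP.memLp_coord _ _).sub (hP.memLp_coord _ _)).const_mul _
  have e1 : ∀ ω : PathSpace m η, ℓ (I.restrict fun s => ω.1 s) = ∑ p : I × Fin m,
      ℓ (Pi.single p.1 (EuclideanSpace.single p.2 1)) * ω.1 p.1 p.2 :=
    fun ω => dual_pi_vec_apply ℓ _
  simp only [e1]
  have hmean : ∫ ω, (∑ p : I × Fin m,
      ℓ (Pi.single p.1 (EuclideanSpace.single p.2 1)) * (shift t ω).1 p.1 p.2) ∂P =
      ∫ ω, (∑ p : I × Fin m,
      ℓ (Pi.single p.1 (EuclideanSpace.single p.2 1)) * ω.1 p.1 p.2) ∂P := by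
    rw [integral_finsetSum _ fun p _ => (hL2' p).integrable (by norm_num),
      integral_finsetSum _ fun p _ => (hL2 p).integrable (by norm_num)]
    refine Finset.sum_congr rfl fun p _ => ?_
    rw [integral_const_mul, integral_const_mul, hP.integral_coord]
    congr 1
    have := integral_sub ((hP.memLp_coord (p.1 + t) p.2).integrable (by norm_num))
      ((hP.memLp_coord t p.2).integrable (by norm_num))
    rw [hP.integral_coord, hP.integral_coord, sub_zero] at this
    exact this
  have hvar : Var[fun ω => ∑ p : I × Fin m,
      ℓ (Pi.single p.1 (EuclideanSpace.single p.2 1)) * (shift t ω).1 p.1 p.2; P] =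
      Var[fun ω => ∑ p : I × Fin m,
      ℓ (Pi.single p.1 (EuclideanSpace.single p.2 1)) * ω.1 p.1 p.2; P] := by
    rw [← covariance_self (memLp_finsetSum _ fun p _ => hL2' p).aestronglyMeasurable.aemeasurable,
      ← covariance_self (memLp_finsetSum _ fun p _ => hL2 p).aestronglyMeasurable.aemeasurable,
      covariance_fun_sum_fun_sum hL2' hL2', covariance_fun_sum_fun_sum hL2 hL2]
    refine Finset.sum_congr rfl fun p _ => Finset.sum_congr rfl fun q _ => ?_
    simp only [covariance_const_mul_left, covariance_const_mul_right]
    rw [hP.covariance_shift hH]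
  rw [hmean, hvar]

theorem isMetricDS_shiftEps (hH : 0 < H) [IsProbabilityMeasure P] (hP : IsFBMLaw H P) (ε : ℝ) :
    IsMetricDS (shiftEps ε) P where
  prob := inferInstance
  measurable := measurable_uncurry_shift.comp
    ((measurable_fst.div_const ε).prodMk measurable_snd)
  zero ω := by simp [shiftEps, shift_zero]
  add s t ω := by simp [shiftEps, shift_shift, add_div]
  preserving t := ⟨measurable_uncurry_shift.comp (measurable_const.prodMk measurable_id),
    hP.map_shift hH _⟩

end MetricDS

/-! ### Temperedness and contracting random dynamical systems -/

theorem continuous_of_contraction {Ω B : Type*} [NormedAddCommGroup B] {φ : ℝ≥0 → Ω → B → B}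
    {κ : ℝ}
    (hc : ∀ t ω y₁ y₂, ‖φ t ω y₁ - φ t ω y₂‖ ≤ Real.exp (-κ * t) * ‖y₁ - y₂‖)
    (t : ℝ≥0) (ω : Ω) : Continuous (φ t ω) :=
  (LipschitzWith.of_dist_le_mul (K := (Real.exp (-κ * t)).toNNReal) fun y₁ y₂ => by
    rw [Real.coe_toNNReal _ (Real.exp_pos _).le, dist_eq_norm, dist_eq_norm]
    exact hc t ω y₁ y₂).continuous

section AbstractRDS

variable {Ω B : Type*} [MeasurableSpace Ω] {θ : ℝ → Ω → Ω}

theorem IsTempered.of_linear_growth {X : Ω → ℝ} (hX : Measurable X) (h0 : ∀ ω, 0 ≤ X ω)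
    (hgrowth : ∀ ω, ∃ K : ℝ, ∀ t, X (θ t ω) ≤ K * (1 + |t|)) : IsTempered θ X where
  measurable := hX
  nonneg := h0
  limit ω := by
    obtain ⟨K, hK⟩ := hgrowth ω
    -- With a constant of at least one the majorant is at least one, where `posLog` is the
    -- logarithm.
    set M := max K 1
    have hM : 1 ≤ M := le_max_right _ _
    have habs : Tendsto (fun t : ℝ => |t|) (cocompact ℝ) atTop :=
      tendsto_norm_cocompact_atTop (E := ℝ)
    have hlim : Tendsto (fun s : ℝ => Real.log (M * (1 + s)) / s) atTop (𝓝 0) := by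
      refine Asymptotics.IsLittleO.tendsto_div_nhds_zero ?_
      have h1 : Tendsto (fun s : ℝ => M * (1 + s)) atTop atTop :=
        (tendsto_atTop_add_const_left _ _ tendsto_id).const_mul_atTop (by positivity)
      refine (Real.isLittleO_log_id_atTop.comp_tendsto h1).trans_isBigO ?_
      refine Asymptotics.IsBigO.const_mul_left (Asymptotics.IsBigO.add ?_
        (Asymptotics.isBigO_refl _ _)) M
      exact (Asymptotics.isLittleO_const_id_atTop (1 : ℝ)).isBigO
    refine squeeze_zero (fun t => div_nonneg Real.posLog_nonneg (abs_nonneg t))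
      (fun t => ?_) (hlim.comp habs)
    simp only [Function.comp_apply]
    have h1 : X (θ t ω) ≤ M * (1 + |t|) :=
      (hK t).trans (mul_le_mul_of_nonneg_right (le_max_left _ _) (by positivity))
    have h2 : 1 ≤ M * (1 + |t|) := by nlinarith [abs_nonneg t]
    gcongr
    rw [← Real.posLog_eq_log (by rwa [abs_of_nonneg (by positivity)])]
    exact Real.posLog_le_posLog (h0 _) h1

theorem IsTempered.mono {X X' : Ω → ℝ} (h : IsTempered θ X) (hX' : Measurable X')
    (h0 : ∀ ω, 0 ≤ X' ω) (hle : ∀ ω, X' ω ≤ X ω) : IsTempered θ X' where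
  measurable := hX'
  nonneg := h0
  limit ω := squeeze_zero (fun t => div_nonneg Real.posLog_nonneg (abs_nonneg t))
    (fun t => div_le_div_of_nonneg_right (Real.posLog_le_posLog (h0 _) (hle _)) (abs_nonneg t))
    (h.limit ω)

/-- For large `|t|` temperedness bounds `X` along the orbit by the exponential of `β / 2 * |t|`; the
other half of the rate gives the decay. -/
theorem IsTempered.tendsto_exp_neg_mul {X : Ω → ℝ} (h : IsTempered θ X) (ω : Ω) {β : ℝ}
    (hβ : 0 < β) :
    Tendsto (fun t : ℝ => Real.exp (-β * |t|) * X (θ t ω)) (cocompact ℝ) (𝓝 0) := by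
  have habs : Tendsto (fun t : ℝ => |t|) (cocompact ℝ) atTop := tendsto_norm_cocompact_atTop (E := ℝ)
  have hlim : Tendsto (fun t : ℝ => Real.exp (-(β / 2) * |t|)) (cocompact ℝ) (𝓝 0) :=
    Real.tendsto_exp_atBot.comp (habs.const_mul_atTop_of_neg (by linarith))
  have hev : ∀ᶠ t : ℝ in cocompact ℝ, Real.posLog (X (θ t ω)) / |t| < β / 2 :=
    (h.limit ω).eventually_lt_const (by positivity)
  refine squeeze_zero' (Eventually.of_forall fun t => mul_nonneg (by positivity) (h.nonneg _))
    ?_ hlim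
  filter_upwards [hev, habs.eventually_gt_atTop 0] with t ht htpos
  have h1 : Real.posLog (X (θ t ω)) ≤ β / 2 * |t| := ((div_lt_iff₀ htpos).1 ht).le
  have h2 : X (θ t ω) ≤ Real.exp (β / 2 * |t|) := by
    rcases (h.nonneg (θ t ω)).eq_or_lt with h0 | h0
    · rw [← h0]; positivity
    · rw [← Real.exp_log h0]
      exact Real.exp_le_exp.2 ((le_max_right _ _).trans h1)
  calc Real.exp (-β * |t|) * X (θ t ω)
      ≤ Real.exp (-β * |t|) * Real.exp (β / 2 * |t|) := by gcongr
    _ = _ := by rw [← Real.exp_add]; ring_nf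

theorem tendsto_neg_coe_nnreal_cocompact :
    Tendsto (fun t : ℝ≥0 => -(t : ℝ)) atTop (cocompact ℝ) :=
  (tendsto_neg_atTop_atBot.comp (NNReal.tendsto_coe_atTop.2 tendsto_id)).mono_right
    atBot_le_cocompact

variable [NormedAddCommGroup B]

theorem IsTemperedRandomSet.norm_le {C : Ω → Set B} (hC : IsTemperedRandomSet θ C) {ω : Ω} {y : B}
    (hy : y ∈ C ω) : ‖y‖ ≤ sSup ((fun y => ‖y‖) '' C ω) := by
  refine le_csSup ?_ (mem_image_of_mem _ hy)
  obtain ⟨K, hK⟩ := (hC.bounded ω).exists_norm_le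
  exact ⟨K, by rintro _ ⟨z, hz, rfl⟩; exact hK z hz⟩

variable [MeasurableSpace B] {P : Measure Ω} {φ : ℝ≥0 → Ω → B → B} {κ : ℝ}

theorem IsMetricDS.add_neg (h : IsMetricDS θ P) (t : ℝ) (ω : Ω) : θ t (θ (-t) ω) = ω := by
  rw [← h.add, add_neg_cancel, h.zero]

/-- Since `Y` is carried along by the cocycle, the error is at most `exp (-κ * t)` times the
distance in the starting fibre. In the forward sense that fibre is fixed; in the pullback sense it
recedes, and temperedness of `D` and `Y` controls the distance there. -/
theorem attractsSelectors_of_contraction (hφ : IsRDS θ P φ)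
    (hc : ∀ t ω y₁ y₂, ‖φ t ω y₁ - φ t ω y₂‖ ≤ Real.exp (-κ * t) * ‖y₁ - y₂‖)
    {Y : Ω → B} (hY : IsRandomFixedPoint θ φ Y) (hYt : IsTempered θ fun ω => ‖Y ω‖)
    {D : Ω → Set B} (hD : IsTemperedRandomSet θ D) : AttractsSelectors θ φ κ D Y := by
  intro y _ hyD ω α hα
  have hκα : 0 < κ - α := sub_pos.2 hα
  have hsum : Tendsto (fun t : ℝ => Real.exp (-(κ - α) * |t|) *
      sSup ((fun y => ‖y‖) '' D (θ t ω)) + Real.exp (-(κ - α) * |t|) * ‖Y (θ t ω)‖)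
      (cocompact ℝ) (𝓝 0) := by
    simpa using (hD.tempered.tendsto_exp_neg_mul ω hκα).add (hYt.tendsto_exp_neg_mul ω hκα)
  have hle : ∀ (t : ℝ≥0) ω', Real.exp (α * t) * ‖φ t ω' (y ω') - Y (θ t ω')‖ ≤
      Real.exp (-(κ - α) * t) * sSup ((fun y => ‖y‖) '' D ω') +
        Real.exp (-(κ - α) * t) * ‖Y ω'‖ := by
    intro t ω'
    rw [← hY.fixed t ω', ← mul_add]
    have e : Real.exp (-(κ - α) * t) = Real.exp (α * t) * Real.exp (-κ * t) := by
      rw [← Real.exp_add]; ring_nf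
    rw [e, mul_assoc]
    gcongr
    refine (hc t ω' _ _).trans ?_
    gcongr
    exact (norm_sub_le _ _).trans (add_le_add_left (hD.norm_le (hyD ω')) _)
  constructor
  · refine squeeze_zero (fun t => by positivity) (fun t => ?_)
      (hsum.comp tendsto_neg_coe_nnreal_cocompact)
    have := hle t (θ (-t) ω)
    rw [hφ.base.add_neg] at this
    simpa using this
  · have hconst : Tendsto (fun t : ℝ≥0 => Real.exp (-(κ - α) * t) *
      sSup ((fun y => ‖y‖) '' D ω) + Real.exp (-(κ - α) * t) * ‖Y ω‖) atTop (𝓝 0) := by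
      have : Tendsto (fun t : ℝ≥0 => Real.exp (-(κ - α) * t)) atTop (𝓝 0) :=
        Real.tendsto_exp_atBot.comp
          ((NNReal.tendsto_coe_atTop.2 tendsto_id).const_mul_atTop_of_neg (by linarith))
      simpa using (this.mul_const _).add (this.mul_const ‖Y ω‖)
    exact squeeze_zero (fun t => by positivity) (fun t => hle t ω) hconst

/-- By the cocycle property the motion started earlier has reached a point of norm at most `R` when
the later one starts at `0`; from then on the two contract. -/
theorem norm_comp_sub_le_of_contraction (hφ : IsRDS θ P φ)
    (hc : ∀ t ω y₁ y₂, ‖φ t ω y₁ - φ t ω y₂‖ ≤ Real.exp (-κ * t) * ‖y₁ - y₂‖)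
    {R : Ω → ℝ} (hbd : ∀ t ω, ‖φ t ω 0‖ ≤ R (θ t ω)) (s t : ℝ≥0) (ω : Ω) :
    ‖φ (t + s) (θ (-(s + t : ℝ)) ω) 0 - φ t (θ (-(t : ℝ)) ω) 0‖ ≤
      Real.exp (-κ * t) * R (θ (-(t : ℝ)) ω) := by
  have e : θ s (θ (-(s + t : ℝ)) ω) = θ (-(t : ℝ)) ω := by
    rw [← hφ.base.add]; congr 1; ring
  rw [hφ.cocycle, e]
  refine (hc _ _ _ _).trans ?_
  gcongr
  have := hbd s (θ (-(s + t : ℝ)) ω)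
  rw [e] at this
  simpa using this

/-- The pullback limit of a contracting random dynamical system. -/
theorem exists_randomFixedPoint_of_contraction [BorelSpace B] [CompleteSpace B]
    (hφ : IsRDS θ P φ) (hκ : 0 < κ)
    (hc : ∀ t ω y₁ y₂, ‖φ t ω y₁ - φ t ω y₂‖ ≤ Real.exp (-κ * t) * ‖y₁ - y₂‖)
    {R : Ω → ℝ} (hR : IsTempered θ R) (hbd : ∀ t ω, ‖φ t ω 0‖ ≤ R (θ t ω)) :
    ∃ Y : Ω → B, IsRandomFixedPoint θ φ Y ∧
      ∀ ω, Tendsto (fun k : ℕ => φ k (θ (-(k : ℝ)) ω) 0) atTop (𝓝 (Y ω)) := by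
  have hnat : Tendsto (fun k : ℕ => -(k : ℝ)) atTop (cocompact ℝ) :=
    (tendsto_neg_atTop_atBot.comp tendsto_natCast_atTop_atTop).mono_right atBot_le_cocompact
  have hdecay : ∀ ω, ∀ β, 0 < β → Tendsto (fun k : ℕ =>
      Real.exp (-β * k) * R (θ (-(k : ℝ)) ω)) atTop (𝓝 0) := fun ω β hβ => by
    simpa [Function.comp_def] using (hR.tendsto_exp_neg_mul ω hβ).comp hnat
  have hcauchy : ∀ ω, CauchySeq fun k : ℕ => φ k (θ (-(k : ℝ)) ω) 0 := by
    intro ω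
    -- Half of the rate absorbs the growth of `R` along the backward orbit, the other half remains
    -- as a geometric ratio.
    obtain ⟨M, hM⟩ := (hdecay ω (κ / 2) (by positivity)).bddAbove_range
    have hr : Real.exp (-(κ / 2)) < 1 := Real.exp_lt_one_iff.2 (by linarith)
    refine cauchySeq_of_le_geometric (Real.exp (-(κ / 2))) M hr fun k => ?_
    have h1 := norm_comp_sub_le_of_contraction hφ hc hbd 1 k ω
    have e : (-((1 : ℝ≥0) + (k : ℝ≥0) : ℝ)) = -((k + 1 : ℕ) : ℝ) := by push_cast; ring
    rw [e] at h1
    rw [dist_comm, dist_eq_norm]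
    have h2 : Real.exp (-κ * k) = Real.exp (-(κ / 2) * k) * Real.exp (-(κ / 2)) ^ k := by
      rw [← Real.exp_nat_mul, ← Real.exp_add]; ring_nf
    have h3 := hM ⟨k, rfl⟩
    simp only [NNReal.coe_natCast, h2] at h1
    push_cast at h1 ⊢
    refine h1.trans ?_
    rw [mul_right_comm]
    gcongr
  choose Y hY using fun ω => cauchySeq_tendsto_of_complete (hcauchy ω)
  refine ⟨Y, ⟨?_, fun t ω => ?_⟩, hY⟩
  · refine measurable_of_tendsto_metrizable (f := fun (k : ℕ) ω => φ k (θ (-(k : ℝ)) ω) 0)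
      (fun k => ?_) (tendsto_pi_nhds.2 hY)
    exact hφ.measurable.comp (measurable_const.prodMk ((hφ.base.measurable.comp
      (measurable_const.prodMk measurable_id)).prodMk measurable_const))
  · have h1 : Tendsto (fun k : ℕ => φ t ω (φ k (θ (-(k : ℝ)) ω) 0)) atTop (𝓝 (φ t ω (Y ω))) :=
      ((continuous_of_contraction hc t ω).tendsto _).comp (hY ω)
    refine tendsto_nhds_unique h1 ?_
    -- Seen from the fibre `θ t ω`, both terms are pullbacks of `0`, started at the times `-(t + k)`
    -- and `-k`, so they merge.
    have h2 : Tendsto (fun k : ℕ => φ t ω (φ k (θ (-(k : ℝ)) ω) 0) -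
        φ k (θ (-(k : ℝ)) (θ t ω)) 0) atTop (𝓝 0) := by
      refine squeeze_zero_norm (fun k => ?_) (hdecay (θ t ω) κ hκ)
      have h3 := norm_comp_sub_le_of_contraction hφ hc hbd t k (θ t ω)
      have e : θ (-(t + (k : ℝ≥0) : ℝ)) (θ t ω) = θ (-(k : ℝ)) ω := by
        rw [← hφ.base.add]; congr 1; push_cast; ring
      have e' : θ (k : ℝ≥0) (θ (-(k : ℝ)) ω) = ω := by
        simpa using hφ.base.add_neg k ω
      rw [e, add_comm (k : ℝ≥0) t, hφ.cocycle, e'] at h3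
      simpa using h3
    simpa using h2.add (hY (θ t ω))

/-- The distance of two fixed points shrinks exponentially along every orbit, while its law does not
change. So the probability that it exceeds `δ` is at most the probability that it exceeds `δ * exp
(κ * k)`, which tends to zero. No temperedness is needed. -/
theorem IsRandomFixedPoint.ae_eq_of_contraction [BorelSpace B] [SecondCountableTopology B]
    (hφ : IsRDS θ P φ) (hκ : 0 < κ)
    (hc : ∀ t ω y₁ y₂, ‖φ t ω y₁ - φ t ω y₂‖ ≤ Real.exp (-κ * t) * ‖y₁ - y₂‖)
    {Y Y' : Ω → B} (hY : IsRandomFixedPoint θ φ Y) (hY' : IsRandomFixedPoint θ φ Y') :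
    Y' =ᵐ[P] Y := by
  have := hφ.base.prob
  have hmeas : Measurable fun ω => ‖Y' ω - Y ω‖ := (hY'.measurable.sub hY.measurable).norm
  have hkey : ∀ δ : ℝ, 0 < δ → P {ω | δ < ‖Y' ω - Y ω‖} = 0 := by
    intro δ hδ
    have hle : ∀ k : ℕ, P {ω | δ < ‖Y' ω - Y ω‖} ≤
        P {ω | δ * Real.exp (κ * k) < ‖Y' ω - Y ω‖} := by
      intro k
      rw [← (hφ.base.preserving k).measure_preimage
        (measurableSet_lt measurable_const hmeas).nullMeasurableSet]
      refine measure_mono fun ω hω => ?_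
      simp only [mem_preimage, mem_ofPred_eq] at hω ⊢
      have h1 := hc k ω (Y' ω) (Y ω)
      rw [hY.fixed, hY'.fixed, neg_mul, Real.exp_neg, NNReal.coe_natCast] at h1
      have h2 : 0 < Real.exp (κ * k) := Real.exp_pos _
      have h3 := hω.trans_le h1
      rwa [inv_mul_eq_div, lt_div_iff₀ h2] at h3
    have hlim : Tendsto (fun k : ℕ => P {ω | δ * Real.exp (κ * k) < ‖Y' ω - Y ω‖}) atTop
        (𝓝 (P (⋂ k : ℕ, {ω | δ * Real.exp (κ * k) < ‖Y' ω - Y ω‖}))) := by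
      refine tendsto_measure_iInter_atTop
        (fun k => (measurableSet_lt measurable_const hmeas).nullMeasurableSet) ?_
        ⟨0, measure_ne_top _ _⟩
      intro a b hab ω hω
      simp only [mem_ofPred_eq] at hω ⊢
      refine lt_of_le_of_lt ?_ hω
      gcongr
    have hempty : (⋂ k : ℕ, {ω | δ * Real.exp (κ * k) < ‖Y' ω - Y ω‖}) = ∅ := by
      refine eq_empty_of_forall_notMem fun ω hω => ?_
      simp only [mem_iInter, mem_ofPred_eq] at hω
      have ht : Tendsto (fun k : ℕ => δ * Real.exp (κ * k)) atTop atTop :=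
        (Real.tendsto_exp_atTop.comp
          (tendsto_natCast_atTop_atTop.const_mul_atTop hκ)).const_mul_atTop hδ
      obtain ⟨k, hk⟩ := (ht.eventually_ge_atTop ‖Y' ω - Y ω‖).exists
      exact absurd (hω k) (not_lt.2 hk)
    rw [hempty, measure_empty] at hlim
    exact le_antisymm (ge_of_tendsto' hlim hle) zero_le
  have hall : ∀ᵐ ω ∂P, ∀ n : ℕ, ¬ (1 / ((n : ℝ) + 1) < ‖Y' ω - Y ω‖) :=
    ae_all_iff.2 fun n => by
      rw [ae_iff]; simpa using hkey (1 / ((n : ℝ) + 1)) (by positivity)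
  filter_upwards [hall] with ω hω
  by_contra hne
  obtain ⟨n, hn⟩ := exists_nat_one_div_lt (norm_pos_iff.2 (sub_ne_zero.2 hne))
  exact hω n hn

theorem isAttractingFixedPointIn_of_contraction [BorelSpace B] [SecondCountableTopology B]
    (hφ : IsRDS θ P φ) (hκ : 0 < κ)
    (hc : ∀ t ω y₁ y₂, ‖φ t ω y₁ - φ t ω y₂‖ ≤ Real.exp (-κ * t) * ‖y₁ - y₂‖)
    {C : Ω → Set B} (hC : IsTemperedRandomSet θ C) (hinv : IsForwardInvariant θ φ C)
    {Y : Ω → B} (hY : IsRandomFixedPoint θ φ Y) (hYC : ∀ ω, Y ω ∈ C ω) :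
    IsAttractingFixedPointIn θ P φ κ C Y := by
  have hYt : IsTempered θ fun ω => ‖Y ω‖ :=
    hC.tempered.mono hY.measurable.norm (fun _ => norm_nonneg _) fun ω => hC.norm_le (hYC ω)
  have hattr : ∀ D, IsTemperedRandomSet θ D → AttractsSelectors θ φ κ D Y :=
    fun D hD => attractsSelectors_of_contraction hφ hc hY hYt hD
  refine ⟨hC, hinv, hY, hYC, fun Y' hY' hY'C => ?_,
    fun Y' hY' => hY.ae_eq_of_contraction hφ hκ hc hY', hYt, hattr⟩
  ext ω
  -- A second fixed point in `C` is a selector of `C` whose pullback is constant in time, so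
  -- attraction at speed `0` forces equality at every `ω`.
  have h := (hattr C hC Y' hY'.measurable hY'C ω 0 hκ).1
  simp only [hY'.fixed, hφ.base.add_neg, zero_mul, Real.exp_zero, one_mul] at h
  exact sub_eq_zero.1 (norm_eq_zero.1 (tendsto_nhds_unique tendsto_const_nhds h))

end AbstractRDS

/-! ### Integrals over the past -/

section HistoryIntegral

variable {E : Type*} [NormedAddCommGroup E]

theorem integrableOn_Iic_comp_div {f : ℝ → E} (hf : IntegrableOn f (Iic 0)) {ε : ℝ} (hε : 0 < ε) :
    IntegrableOn (fun r => f (r / ε)) (Iic 0) := by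
  rw [← integrable_indicator_iff measurableSet_Iic] at hf ⊢
  refine (hf.comp_div hε.ne').congr (Eventually.of_forall fun r => ?_)
  simp [indicator, div_nonpos_iff, hε.le, hε.not_ge]

theorem integrableOn_Iic_of_continuous {f : ℝ → E} (hf : Continuous f)
    (hint : IntegrableOn f (Iic 0)) (t : ℝ) : IntegrableOn f (Iic t) := by
  refine (hint.union (hf.integrableOn_Icc (a := 0) (b := t))).mono_set fun x hx => ?_
  rcases le_total x 0 with h | h
  · exact Or.inl h
  · exact Or.inr ⟨h, hx⟩

/-- Each factor `1 + |r|` is at most `1 + 4 / c` times an exponential of rate `c / 4`, so the square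
costs half of the rate. -/
theorem sq_one_add_abs_mul_exp_le {c : ℝ} (hc : 0 < c) {r : ℝ} (hr : r ≤ 0) :
    (1 + |r|) ^ 2 * Real.exp (c * r) ≤ (1 + 4 / c) ^ 2 * Real.exp (c / 2 * r) := by
  have h1 : 1 + |r| ≤ (1 + 4 / c) * Real.exp (-(c / 4) * r) := by
    have h2 : 1 ≤ Real.exp (-(c / 4) * r) := Real.one_le_exp (by nlinarith)
    have h3 : -(c / 4) * r ≤ Real.exp (-(c / 4) * r) :=
      (by linarith : _ ≤ -(c / 4) * r + 1).trans (Real.add_one_le_exp _)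
    have h4 : |r| = 4 / c * (-(c / 4) * r) := by
      rw [abs_of_nonpos hr]; field_simp
    rw [h4, add_mul, one_mul]
    gcongr
  calc (1 + |r|) ^ 2 * Real.exp (c * r)
      ≤ ((1 + 4 / c) * Real.exp (-(c / 4) * r)) ^ 2 * Real.exp (c * r) := by gcongr
    _ = _ := by
        rw [mul_pow, ← Real.exp_nat_mul, mul_assoc, ← Real.exp_add]
        congr 2
        push_cast; ring

theorem integrableOn_Iic_of_norm_le {f : ℝ → E} (hf : Continuous f) {c K : ℝ} (hc : 0 < c)
    (hle : ∀ r ≤ 0, ‖f r‖ ≤ K * ((1 + |r|) ^ 2 * Real.exp (c * r))) :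
    IntegrableOn f (Iic 0) := by
  have hmaj : IntegrableOn (fun r => |K| * ((1 + 4 / c) ^ 2 * Real.exp (c / 2 * r))) (Iic 0) :=
    ((integrableOn_exp_mul_Iic (half_pos hc) 0).const_mul _).const_mul _
  refine Integrable.mono' hmaj hf.aestronglyMeasurable
    ((ae_restrict_iff' measurableSet_Iic).2 (Eventually.of_forall fun r hr => ?_))
  refine (hle r hr).trans ?_
  calc K * ((1 + |r|) ^ 2 * Real.exp (c * r)) ≤ |K| * ((1 + |r|) ^ 2 * Real.exp (c * r)) := by
        gcongr; exact le_abs_self K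
    _ ≤ _ := mul_le_mul_of_nonneg_left (sq_one_add_abs_mul_exp_le hc hr) (abs_nonneg K)

variable [NormedSpace ℝ E]

theorem integral_Iic_comp_div (f : ℝ → E) {ε : ℝ} (hε : 0 < ε) :
    ∫ r in Iic (0 : ℝ), f (r / ε) = ε • ∫ r in Iic (0 : ℝ), f r := by
  rw [← integral_indicator measurableSet_Iic, ← integral_indicator measurableSet_Iic,
    ← abs_of_pos hε, ← Measure.integral_comp_div, abs_of_pos hε]
  refine integral_congr_ae (Eventually.of_forall fun r => ?_)
  simp [indicator, div_nonpos_iff, hε.le, hε.not_ge]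

theorem integral_Iic_comp_add (f : ℝ → E) (t : ℝ) :
    ∫ r in Iic (0 : ℝ), f (r + t) = ∫ r in Iic t, f r := by
  rw [← integral_indicator measurableSet_Iic, ← integral_indicator measurableSet_Iic,
    ← integral_add_right_eq_self ((Iic t).indicator f) t]
  refine integral_congr_ae (Eventually.of_forall fun r => ?_)
  simp [indicator]

theorem hasDerivAt_integral_Iic [CompleteSpace E] {f : ℝ → E} (hf : Continuous f)
    (hint : IntegrableOn f (Iic 0)) (t : ℝ) :
    HasDerivAt (fun t => ∫ s in Iic t, f s) (f t) t := by
  have h : (fun t => ∫ s in Iic t, f s) =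
      fun t => (∫ s in Iic (0 : ℝ), f s) + ∫ s in (0 : ℝ)..t, f s := by
    ext t
    rw [← intervalIntegral.integral_Iic_sub_Iic hint (integrableOn_Iic_of_continuous hf hint t)]
    abel
  rw [h]
  exact (intervalIntegral.integral_hasDerivAt_right (hf.intervalIntegrable _ _)
    (hf.stronglyMeasurableAtFilter _ _) hf.continuousAt).const_add _

end HistoryIntegral

/-! ### The semigroup of a coercive operator -/

section Semigroup

variable {E : Type*} [NormedAddCommGroup E] [InnerProductSpace ℝ E] [CompleteSpace E]
  {A : E →L[ℝ] E} {lam : ℝ}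

theorem exp_add_smul (A : E →L[ℝ] E) (s t : ℝ) :
    NormedSpace.exp ((s + t) • A) = NormedSpace.exp (s • A) * NormedSpace.exp (t • A) := by
  let := NormedAlgebra.restrictScalars ℚ ℝ (E →L[ℝ] E)
  rw [add_smul, NormedSpace.exp_add_of_commute (((Commute.refl A).smul_left _).smul_right _)]

theorem hasDerivAt_exp_smul_apply (A : E →L[ℝ] E) (y : E) (r : ℝ) :
    HasDerivAt (fun r : ℝ => NormedSpace.exp (r • A) y) (A (NormedSpace.exp (r • A) y)) r := by
  have := (hasDerivAt_exp_smul_const' A r).clm_apply (hasDerivAt_const r y)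
  simpa using this

theorem continuous_exp_smul (A : E →L[ℝ] E) : Continuous fun r : ℝ => NormedSpace.exp (r • A) :=
  (differentiable_exp_smul_const ℝ A).continuous

/-- By coercivity the squared norm of the orbit, weighted with `exp (-(2 * lam) * r)`, is
nondecreasing in `r`; compare its value at `r` with the one at `0`. -/
theorem norm_exp_smul_apply_le (hA : ∀ y, lam * ‖y‖ ^ 2 ≤ inner ℝ (A y) y) {r : ℝ} (hr : r ≤ 0)
    (y : E) : ‖NormedSpace.exp (r • A) y‖ ≤ Real.exp (lam * r) * ‖y‖ := by
  have hderiv : ∀ r : ℝ, HasDerivAt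
      (fun r : ℝ => Real.exp (-(2 * lam) * r) * ‖NormedSpace.exp (r • A) y‖ ^ 2)
      (Real.exp (-(2 * lam) * r) * (2 * (inner ℝ (A (NormedSpace.exp (r • A) y))
        (NormedSpace.exp (r • A) y) - lam * ‖NormedSpace.exp (r • A) y‖ ^ 2))) r := by
    intro r
    have h1 : HasDerivAt (fun r : ℝ => Real.exp (-(2 * lam) * r))
        (Real.exp (-(2 * lam) * r) * -(2 * lam)) r := by
      simpa using ((hasDerivAt_id r).const_mul (-(2 * lam))).exp
    have h2 := (hasDerivAt_exp_smul_apply A y r).norm_sq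
    convert! h1.mul h2 using 1
    rw [real_inner_comm]
    ring
  have hmono : Monotone
      (fun r : ℝ => Real.exp (-(2 * lam) * r) * ‖NormedSpace.exp (r • A) y‖ ^ 2) :=
    monotone_of_hasDerivAt_nonneg hderiv fun r =>
      mul_nonneg (Real.exp_pos _).le (by have := hA (NormedSpace.exp (r • A) y); linarith)
  have h := hmono hr
  simp only [mul_zero, Real.exp_zero, zero_smul, NormedSpace.exp_zero, one_mul,
    one_apply_eq_self] at h
  refine le_of_sq_le_sq ?_ (by positivity)
  have e : (Real.exp (lam * r) * ‖y‖) ^ 2 = Real.exp (2 * lam * r) * ‖y‖ ^ 2 := by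
    rw [mul_pow, ← Real.exp_nat_mul]; congr 2; push_cast; ring
  rw [e]
  calc ‖NormedSpace.exp (r • A) y‖ ^ 2
      = Real.exp (2 * lam * r) *
          (Real.exp (-(2 * lam) * r) * ‖NormedSpace.exp (r • A) y‖ ^ 2) := by
        rw [← mul_assoc, ← Real.exp_add]; simp
    _ ≤ _ := by gcongr

/-- The resolvent integral of the semigroup. -/
theorem apply_integral_exp_smul (hA : ∀ y, lam * ‖y‖ ^ 2 ≤ inner ℝ (A y) y) (hlam : 0 < lam)
    (y : E) : IntegrableOn (fun r : ℝ => NormedSpace.exp (r • A) y) (Iic 0) ∧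
      A (∫ r in Iic (0 : ℝ), NormedSpace.exp (r • A) y) = y := by
  have hcont : Continuous fun r : ℝ => NormedSpace.exp (r • A) y :=
    (continuous_exp_smul A).clm_apply continuous_const
  have hint : IntegrableOn (fun r : ℝ => NormedSpace.exp (r • A) y) (Iic 0) := by
    refine Integrable.mono' ((integrableOn_exp_mul_Iic hlam 0).mul_const ‖y‖)
      hcont.aestronglyMeasurable
      ((ae_restrict_iff' measurableSet_Iic).2 (Eventually.of_forall fun r hr => ?_))
    exact norm_exp_smul_apply_le hA hr y
  refine ⟨hint, ?_⟩
  rw [← ContinuousLinearMap.integral_comp_comm A hint]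
  have hlim : Tendsto (fun r : ℝ => NormedSpace.exp (r • A) y) atBot (𝓝 0) := by
    have h0 : Tendsto (fun r : ℝ => Real.exp (lam * r) * ‖y‖) atBot (𝓝 0) := by
      have : Tendsto (fun r : ℝ => Real.exp (lam * r)) atBot (𝓝 0) :=
        Real.tendsto_exp_atBot.comp (tendsto_id.const_mul_atBot hlam)
      simpa using this.mul_const ‖y‖
    refine squeeze_zero_norm' ?_ h0
    filter_upwards [eventually_le_atBot 0] with r hr using norm_exp_smul_apply_le hA hr y
  -- The integrand is the derivative of the orbit of `y`, which decays at `-∞`, so only the boundary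
  -- value `y` at `0` remains.
  have := integral_Iic_of_hasDerivAt_of_tendsto' (a := 0)
    (fun r _ => hasDerivAt_exp_smul_apply A y r) (A.integrable_comp hint) hlim
  simpa using this

/-- The convolution of the semigroup with the history of a path solves the linear equation. -/
theorem hasDerivAt_integral_exp_smul {f : ℝ → E} (hf : Continuous f)
    (hint : IntegrableOn (fun r : ℝ => NormedSpace.exp (r • A) (f r)) (Iic 0)) (t : ℝ) :
    HasDerivAt (fun t => ∫ r in Iic (0 : ℝ), NormedSpace.exp (r • A) (f (r + t)))
      (f t - A (∫ r in Iic (0 : ℝ), NormedSpace.exp (r • A) (f (r + t)))) t := by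
  have hcont : Continuous fun r : ℝ => NormedSpace.exp (r • A) (f r) :=
    (continuous_exp_smul A).clm_apply hf
  -- Translation moves `t` out of `f` into the semigroup and the upper limit, so `f`, which is
  -- merely continuous, is never differentiated.
  have hW : ∀ t, ∫ r in Iic (0 : ℝ), NormedSpace.exp (r • A) (f (r + t)) =
      NormedSpace.exp ((-t) • A) (∫ r in Iic t, NormedSpace.exp (r • A) (f r)) := by
    intro t
    rw [← ContinuousLinearMap.integral_comp_comm (NormedSpace.exp ((-t) • A))
      (integrableOn_Iic_of_continuous hcont hint t),
      ← integral_Iic_comp_add _ t]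
    refine setIntegral_congr_fun measurableSet_Iic fun r _ => ?_
    have : NormedSpace.exp (r • A) =
        NormedSpace.exp ((-t) • A) * NormedSpace.exp ((r + t) • A) := by
      rw [← exp_add_smul]; congr 2; ring
    rw [this]
    rfl
  have hneg : HasDerivAt (fun t : ℝ => NormedSpace.exp ((-t) • A))
      (-(A * NormedSpace.exp ((-t) • A))) t := by
    have := (hasDerivAt_exp_smul_const' A (-t)).scomp t (hasDerivAt_neg t)
    simpa [Function.comp_def] using this
  have h := hneg.clm_apply (hasDerivAt_integral_Iic hcont hint t)
  simp only [hW]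
  convert! h using 1
  have : NormedSpace.exp ((-t) • A) (NormedSpace.exp (t • A) (f t)) = f t := by
    rw [← mul_apply_eq_comp, ← exp_add_smul]
    simp
  rw [this]
  simp
  abel

end Semigroup

/-! ### The stationary Ornstein-Uhlenbeck process -/

section OrnsteinUhlenbeck

variable {m : ℕ} {η : ℝ} {A : Vec m →L[ℝ] Vec m} {lam : ℝ}

theorem exists_path_norm_le (ω : PathSpace m η) : ∃ c : ℝ, 0 ≤ c ∧ ∀ s, ‖ω.1 s‖ ≤ c + |s| := by
  have h := (ω.2.2.2.bound (c := 1) one_pos)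
  obtain ⟨K, hK, hKs⟩ := mem_cocompact.1 h
  obtain ⟨c, hc⟩ := (hK.image ω.1.continuous).isBounded.exists_norm_le
  refine ⟨max c 0, le_max_right _ _, fun s => ?_⟩
  by_cases hs : s ∈ K
  · have := hc _ (mem_image_of_mem _ hs)
    exact (this.trans (le_max_left _ _)).trans (le_add_of_nonneg_right (abs_nonneg s))
  · have := hKs hs
    simp only [mem_ofPred_eq, one_mul, Real.norm_eq_abs] at this
    exact this.trans (le_add_of_nonneg_left (le_max_right _ _))

theorem integrableOn_sq_mul_exp {c : ℝ} (hc : 0 < c) :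
    IntegrableOn (fun r : ℝ => (1 + |r|) ^ 2 * Real.exp (c * r)) (Iic 0) :=
  integrableOn_Iic_of_norm_le (by fun_prop) hc (K := 1) fun r _ => by
    rw [one_mul, Real.norm_of_nonneg (by positivity)]

theorem integral_sq_mul_exp_nonneg (c : ℝ) :
    0 ≤ ∫ r in Iic (0 : ℝ), (1 + |r|) ^ 2 * Real.exp (c * r) :=
  integral_nonneg fun r => by positivity

theorem norm_exp_smul_path_le (hA : ∀ y, lam * ‖y‖ ^ 2 ≤ inner ℝ (A y) y) {f : ℝ → Vec m} {K : ℝ}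
    (hK : ∀ r, ‖f r‖ ≤ K * (1 + |r|)) {r : ℝ} (hr : r ≤ 0) :
    ‖NormedSpace.exp (r • A) (f r)‖ ≤ K * ((1 + |r|) ^ 2 * Real.exp (lam * r)) := by
  have hK0 : 0 ≤ K := by simpa using (norm_nonneg _).trans (hK 0)
  calc ‖NormedSpace.exp (r • A) (f r)‖ ≤ Real.exp (lam * r) * ‖f r‖ :=
        norm_exp_smul_apply_le hA hr _
    _ ≤ Real.exp (lam * r) * (K * (1 + |r|)) := by gcongr; exact hK r
    -- A first power would do; the square lets one majorant serve both this integral and the square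
    -- radius.
    _ ≤ Real.exp (lam * r) * (K * (1 + |r|) ^ 2) := by
        gcongr; nlinarith [abs_nonneg r]
    _ = _ := by ring

theorem integrableOn_exp_smul_path (hA : ∀ y, lam * ‖y‖ ^ 2 ≤ inner ℝ (A y) y) (hlam : 0 < lam)
    {f : ℝ → Vec m} (hf : Continuous f) {K : ℝ} (hK : ∀ r, ‖f r‖ ≤ K * (1 + |r|)) :
    IntegrableOn (fun r : ℝ => NormedSpace.exp (r • A) (f r)) (Iic 0) :=
  integrableOn_Iic_of_norm_le ((continuous_exp_smul A).clm_apply hf) hlam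
    fun _ hr => norm_exp_smul_path_le hA hK hr

theorem norm_integral_exp_smul_path_le (hA : ∀ y, lam * ‖y‖ ^ 2 ≤ inner ℝ (A y) y)
    (hlam : 0 < lam) {f : ℝ → Vec m} {K : ℝ} (hK : ∀ r, ‖f r‖ ≤ K * (1 + |r|)) :
    ‖∫ r in Iic (0 : ℝ), NormedSpace.exp (r • A) (f r)‖ ≤
      K * ∫ r in Iic (0 : ℝ), (1 + |r|) ^ 2 * Real.exp (lam * r) := by
  rw [← integral_const_mul]
  exact norm_integral_le_of_norm_le ((integrableOn_sq_mul_exp hlam).const_mul K)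
    ((ae_restrict_iff' measurableSet_Iic).2
      (Eventually.of_forall fun r hr => norm_exp_smul_path_le hA hK hr))

theorem norm_path_add_le {ω : PathSpace m η} {c : ℝ} (hc : 0 ≤ c) (hω : ∀ s, ‖ω.1 s‖ ≤ c + |s|)
    (t r : ℝ) : ‖ω.1 (r + t)‖ ≤ (c + 1 + |t|) * (1 + |r|) := by
  have h1 := hω (r + t)
  have h2 := abs_add_le r t
  have h3 := mul_nonneg (add_nonneg hc (abs_nonneg t)) (abs_nonneg r)
  nlinarith

theorem ouIntegrand_eq_comp_div (A : Vec m →L[ℝ] Vec m) (ε : ℝ) (ω : PathSpace m η) (r : ℝ) :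
    ouIntegrand A ε ω r = ouIntegrand A 1 ω (r / ε) := by
  simp [ouIntegrand, driver]

/-- The redundant `r + 0` matches the history integrals at a general time `t`. -/
theorem ouIntegrand_one (A : Vec m →L[ℝ] Vec m) (ω : PathSpace m η) :
    ouIntegrand A 1 ω = fun r => NormedSpace.exp (r • A) (ω.1 (r + 0)) := by
  ext1 r
  simp [ouIntegrand, driver]

/-- The substitution `r ↦ r / ε` produces a factor `ε` that cancels the prefactor `1 / ε`. Thus `ε`
enters the stationary process only through the base flow. -/
theorem ou_eq_one (A : Vec m →L[ℝ] Vec m) {ε : ℝ} (hε : 0 < ε) (ω : PathSpace m η) :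
    ou A ε ω = ou A 1 ω := by
  have h := integral_Iic_comp_div (ouIntegrand A 1 ω) hε
  simp only [← ouIntegrand_eq_comp_div] at h
  simp [ou, h, smul_smul, hε.ne']

theorem integrableOn_exp_smul_shifted (hA : ∀ y, lam * ‖y‖ ^ 2 ≤ inner ℝ (A y) y) (hlam : 0 < lam)
    (ω : PathSpace m η) (t : ℝ) :
    IntegrableOn (fun r : ℝ => NormedSpace.exp (r • A) (ω.1 (r + t))) (Iic 0) := by
  obtain ⟨c, hc, hω⟩ := exists_path_norm_le ω
  exact integrableOn_exp_smul_path hA hlam (ω.1.continuous.comp (continuous_add_const t))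
    (norm_path_add_le hc hω t)

theorem integrableOn_ouIntegrand (hA : ∀ y, lam * ‖y‖ ^ 2 ≤ inner ℝ (A y) y) (hlam : 0 < lam)
    {ε : ℝ} (hε : 0 < ε) (ω : PathSpace m η) : IntegrableOn (ouIntegrand A ε ω) (Iic 0) := by
  have h := integrableOn_exp_smul_shifted hA hlam ω 0
  rw [← ouIntegrand_one] at h
  simpa only [← ouIntegrand_eq_comp_div] using integrableOn_Iic_comp_div h hε

/-- The constant `ω t` subtracted by the shift is reproduced by the resolvent identity. All
roughness in `t` sits in that term; the history integral is differentiable. -/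
theorem ou_shift (hA : ∀ y, lam * ‖y‖ ^ 2 ≤ inner ℝ (A y) y) (hlam : 0 < lam)
    (ω : PathSpace m η) (t : ℝ) :
    ou A 1 (shift t ω) =
      ω.1 t - A (∫ r in Iic (0 : ℝ), NormedSpace.exp (r • A) (ω.1 (r + t))) := by
  obtain ⟨hi, he⟩ := apply_integral_exp_smul hA hlam (ω.1 t)
  rw [ou, ouIntegrand_one]
  simp only [shift_apply, add_zero, map_sub, div_one, one_smul]
  rw [integral_sub (integrableOn_exp_smul_shifted hA hlam ω t) hi, map_sub, he]
  abel

theorem hasDerivAt_ou_history (hA : ∀ y, lam * ‖y‖ ^ 2 ≤ inner ℝ (A y) y) (hlam : 0 < lam)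
    (ω : PathSpace m η) (t : ℝ) :
    HasDerivAt (fun t => A (∫ r in Iic (0 : ℝ), NormedSpace.exp (r • A) (ω.1 (r + t))))
      (A (ou A 1 (shift t ω))) t := by
  rw [ou_shift hA hlam]
  exact A.hasFDerivAt.comp_hasDerivAt t (hasDerivAt_integral_exp_smul ω.1.continuous
    (by simpa using integrableOn_exp_smul_shifted hA hlam ω 0) t)

theorem continuous_ou_shift (hA : ∀ y, lam * ‖y‖ ^ 2 ≤ inner ℝ (A y) y) (hlam : 0 < lam)
    (ω : PathSpace m η) : Continuous fun t : ℝ => ou A 1 (shift t ω) := by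
  simp only [ou_shift hA hlam]
  exact ω.1.continuous.sub (continuous_iff_continuousAt.2 fun t =>
    (hasDerivAt_ou_history hA hlam ω t).continuousAt)

theorem ou_shift_sub (hA : ∀ y, lam * ‖y‖ ^ 2 ≤ inner ℝ (A y) y) (hlam : 0 < lam)
    (ω : PathSpace m η) (s t : ℝ) :
    ou A 1 (shift t ω) = ou A 1 (shift s ω) - (∫ r in s..t, A (ou A 1 (shift r ω))) +
      (ω.1 t - ω.1 s) := by
  rw [intervalIntegral.integral_eq_sub_of_hasDerivAt
    (fun r _ => hasDerivAt_ou_history hA hlam ω r)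
    ((A.continuous.comp (continuous_ou_shift hA hlam ω)).intervalIntegrable _ _),
    ou_shift hA hlam, ou_shift hA hlam]
  abel

theorem ou_shiftEps (A : Vec m →L[ℝ] Vec m) {ε : ℝ} (hε : 0 < ε) (ω : PathSpace m η) (t : ℝ) :
    ou A ε (shiftEps ε t ω) = ou A 1 (shift (t / ε) ω) := ou_eq_one A hε _

theorem continuous_ou_shiftEps (hA : ∀ y, lam * ‖y‖ ^ 2 ≤ inner ℝ (A y) y) (hlam : 0 < lam)
    {ε : ℝ} (hε : 0 < ε) (ω : PathSpace m η) :
    Continuous fun t : ℝ => ou A ε (shiftEps ε t ω) := by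
  simp only [ou_shiftEps A hε]
  exact (continuous_ou_shift hA hlam ω).comp (continuous_id.div_const ε)

theorem ou_shiftEps_sub (hA : ∀ y, lam * ‖y‖ ^ 2 ≤ inner ℝ (A y) y) (hlam : 0 < lam)
    {ε : ℝ} (hε : 0 < ε) (ω : PathSpace m η) (s t : ℝ) :
    ou A ε (shiftEps ε t ω) = ou A ε (shiftEps ε s ω) -
      (1 / ε) • (∫ r in s..t, A (ou A ε (shiftEps ε r ω))) +
      (driver ε ω t - driver ε ω s) := by
  simp only [ou_shiftEps A hε]
  have h := intervalIntegral.integral_comp_div (a := s) (b := t)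
    (fun r => A (ou A 1 (shift r ω))) hε.ne'
  rw [h, smul_smul, one_div_mul_cancel hε.ne', one_smul]
  exact ou_shift_sub hA hlam ω _ _

theorem exists_norm_ou_shift_le (hA : ∀ y, lam * ‖y‖ ^ 2 ≤ inner ℝ (A y) y) (hlam : 0 < lam)
    (ω : PathSpace m η) :
    ∃ K : ℝ, 0 ≤ K ∧ ∀ t, ‖ou A 1 (shift t ω)‖ ≤ K * (1 + |t|) := by
  obtain ⟨c, hc, hω⟩ := exists_path_norm_le ω
  set J := ∫ r in Iic (0 : ℝ), (1 + |r|) ^ 2 * Real.exp (lam * r)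
  have hJ : 0 ≤ J := integral_sq_mul_exp_nonneg lam
  refine ⟨(1 + ‖A‖ * J) * (c + 1), by positivity, fun t => ?_⟩
  have h1 : c + 1 + |t| ≤ (c + 1) * (1 + |t|) := by nlinarith [mul_nonneg hc (abs_nonneg t)]
  rw [ou_shift hA hlam]
  calc _ ≤ (c + |t|) + ‖A‖ * ((c + 1 + |t|) * J) := by
        refine (norm_sub_le _ _).trans (add_le_add (hω t) ((A.le_opNorm _).trans ?_))
        gcongr
        exact norm_integral_exp_smul_path_le hA hlam (norm_path_add_le hc hω t)
    _ ≤ (1 + ‖A‖ * J) * (c + 1 + |t|) := by linarith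
    _ ≤ (1 + ‖A‖ * J) * ((c + 1) * (1 + |t|)) := by gcongr
    _ = _ := by ring

theorem measurable_ou (A : Vec m →L[ℝ] Vec m) (ε : ℝ) :
    Measurable fun ω : PathSpace m η => ou A ε ω := by
  have h : Measurable fun p : PathSpace m η × ℝ => ouIntegrand A ε p.1 p.2 := by
    have h1 : Measurable fun p : PathSpace m η × ℝ => p.1.1 (p.2 / ε) :=
      measurable_uncurry_eval.comp ((measurable_snd.div_const ε).prodMk measurable_fst)
    have h2 : Continuous fun q : ℝ × Vec m => NormedSpace.exp ((q.1 / ε) • A) q.2 :=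
      ((continuous_exp_smul A).comp (continuous_fst.div_const ε)).clm_apply continuous_snd
    exact h2.measurable.comp (measurable_snd.prodMk h1)
  have h3 := (h.stronglyMeasurable.integral_prod_right'
    (ν := volume.restrict (Iic (0 : ℝ)))).measurable
  exact ((A.measurable.comp h3).const_smul (1 / ε)).neg

end OrnsteinUhlenbeck

/-! ### Global solutions by Picard iteration -/

section GlobalODE

variable {E : Type*} [NormedAddCommGroup E] [NormedSpace ℝ E]

/-- `u` solves `u' = F(t, u)`, `u(0) = y₀`, on `[0, ∞)`. -/
def IsForwardSolution (F : ℝ → E → E) (y₀ : E) (u : ℝ → E) : Prop :=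
  u 0 = y₀ ∧ ∀ t : ℝ, 0 ≤ t → HasDerivWithinAt u (F t (u t)) (Ici 0) t

theorem IsForwardSolution.continuousOn {F : ℝ → E → E} {y₀ : E} {u : ℝ → E}
    (h : IsForwardSolution F y₀ u) : ContinuousOn u (Ici 0) :=
  fun t ht => (h.2 t ht).continuousWithinAt

/-- The Picard iterates. -/
noncomputable def picardIterate (F : ℝ → E → E) (y₀ : E) : ℕ → ℝ → E
  | 0 => fun _ => y₀
  | k + 1 => fun t => y₀ + ∫ s in (0 : ℝ)..t, F s (picardIterate F y₀ k s)

variable {F : ℝ → E → E} {K : ℝ}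

theorem continuous_picardIterate (hF : Continuous fun p : ℝ × E => F p.1 p.2) (y₀ : E) (k : ℕ) :
    Continuous (picardIterate F y₀ k) := by
  induction k with
  | zero => exact continuous_const
  | succ k ih =>
    have hc : Continuous fun s => F s (picardIterate F y₀ k s) :=
      hF.comp (continuous_id.prodMk ih)
    exact continuous_const.add
      (intervalIntegral.continuous_primitive (fun a b => hc.intervalIntegrable a b) 0)

/-- Integrating `K * exp (2 * K * s)` gains a factor `1 / 2`. With this weight the iteration
contracts on every interval `[0, T]`, so no local solutions have to be patched together. -/
theorem norm_picardIterate_sub_le (hF : Continuous fun p : ℝ × E => F p.1 p.2) (hK : 0 < K)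
    (hL : ∀ t y₁ y₂, ‖F t y₁ - F t y₂‖ ≤ K * ‖y₁ - y₂‖) {y₀ : E} {T M : ℝ}
    (hM : ∀ t ∈ Icc 0 T, ‖picardIterate F y₀ 1 t - y₀‖ ≤ M) (k : ℕ) :
    ∀ t ∈ Icc 0 T, ‖picardIterate F y₀ (k + 1) t - picardIterate F y₀ k t‖ ≤
      M * (1 / 2) ^ k * Real.exp (2 * K * t) := by
  induction k with
  | zero =>
    intro t ht
    have h0 : 0 ≤ M := (norm_nonneg _).trans (hM t ht)
    have h1 : 1 ≤ Real.exp (2 * K * t) := Real.one_le_exp (by have := ht.1; positivity)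
    calc _ ≤ M := hM t ht
      _ ≤ _ := by rw [pow_zero, mul_one]; exact le_mul_of_one_le_right h0 h1
  | succ k ih =>
    intro t ht
    have h0 : 0 ≤ M := (norm_nonneg _).trans (hM t ht)
    have hc : ∀ k, Continuous fun s => F s (picardIterate F y₀ k s) := fun k =>
      hF.comp (continuous_id.prodMk (continuous_picardIterate hF y₀ k))
    have e : picardIterate F y₀ (k + 1 + 1) t - picardIterate F y₀ (k + 1) t =
        ∫ s in (0 : ℝ)..t, (F s (picardIterate F y₀ (k + 1) s) - F s (picardIterate F y₀ k s)) := by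
      rw [intervalIntegral.integral_sub ((hc _).intervalIntegrable _ _)
        ((hc _).intervalIntegrable _ _)]
      simp only [picardIterate]
      abel
    have hprim : ∀ s : ℝ, HasDerivAt
        (fun s => M * (1 / 2) ^ (k + 1) * Real.exp (2 * K * s))
        (K * (M * (1 / 2) ^ k * Real.exp (2 * K * s))) s := by
      intro s
      have := (((hasDerivAt_id s).const_mul (2 * K)).exp).const_mul (M * (1 / 2) ^ (k + 1))
      convert! this using 1
      simp only [id, mul_one, pow_succ]
      ring
    have hcont : Continuous fun s => K * (M * (1 / 2) ^ k * Real.exp (2 * K * s)) := by fun_prop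
    rw [e]
    calc _ ≤ ∫ s in (0 : ℝ)..t, K * (M * (1 / 2) ^ k * Real.exp (2 * K * s)) := by
          refine intervalIntegral.norm_integral_le_of_norm_le ht.1
            (Eventually.of_forall fun s hs => ?_) (hcont.intervalIntegrable _ _)
          refine (hL _ _ _).trans ?_
          gcongr
          exact ih s ⟨hs.1.le, hs.2.trans ht.2⟩
      _ = M * (1 / 2) ^ (k + 1) * Real.exp (2 * K * t) - M * (1 / 2) ^ (k + 1) := by
          rw [intervalIntegral.integral_eq_sub_of_hasDerivAt (fun s _ => hprim s)
            (hcont.intervalIntegrable _ _)]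
          simp
      _ ≤ _ := sub_le_self _ (by positivity)

variable [CompleteSpace E]

theorem hasDerivWithinAt_integral_Ici {G : ℝ → E} (hG : ContinuousOn G (Ici 0)) {t : ℝ}
    (ht : 0 ≤ t) : HasDerivWithinAt (fun t => ∫ s in (0 : ℝ)..t, G s) (G t) (Ici 0) t := by
  -- Freezing `G` at its value in `0` for negative times makes it continuous on the whole line
  -- without changing the integrals in question.
  have hc : Continuous fun s => G (max s 0) :=
    hG.comp_continuous (by fun_prop) fun s => le_max_right s 0
  have h := (intervalIntegral.integral_hasDerivAt_right (hc.intervalIntegrable 0 t)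
    (hc.stronglyMeasurableAtFilter _ _) hc.continuousAt).hasDerivWithinAt (s := Ici 0)
  rw [max_eq_left ht] at h
  refine h.congr_of_mem (fun s hs => ?_) ht
  refine intervalIntegral.integral_congr fun r hr => ?_
  rw [uIcc_of_le hs] at hr
  simp [max_eq_left hr.1]

theorem isForwardSolution_of_integral {u : ℝ → E} {y₀ : E}
    (hF : Continuous fun p : ℝ × E => F p.1 p.2) (hu : ContinuousOn u (Ici 0))
    (heq : ∀ t, 0 ≤ t → u t = y₀ + ∫ s in (0 : ℝ)..t, F s (u s)) :
    IsForwardSolution F y₀ u := by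
  refine ⟨by simpa using heq 0 le_rfl, fun t ht => ?_⟩
  have hG : ContinuousOn (fun s => F s (u s)) (Ici 0) :=
    hF.comp_continuousOn (continuousOn_id.prodMk hu)
  exact ((hasDerivWithinAt_integral_Ici hG ht).const_add y₀).congr_of_mem (fun s hs => heq s hs) ht

theorem IsForwardSolution.eq_integral {u : ℝ → E} {y₀ : E}
    (hF : Continuous fun p : ℝ × E => F p.1 p.2) (h : IsForwardSolution F y₀ u) {t : ℝ}
    (ht : 0 ≤ t) : u t = y₀ + ∫ s in (0 : ℝ)..t, F s (u s) := by
  have hG : ContinuousOn (fun s => F s (u s)) (Ici 0) :=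
    hF.comp_continuousOn (continuousOn_id.prodMk h.continuousOn)
  have hsub : Icc 0 t ⊆ Ici (0 : ℝ) := Icc_subset_Ici_self
  rw [intervalIntegral.integral_eq_sub_of_hasDerivAt_of_le ht (h.continuousOn.mono hsub)
    (fun s hs => (h.2 s hs.1.le).hasDerivAt (Ici_mem_nhds hs.1))
    ((hG.mono hsub).intervalIntegrable_of_Icc ht), h.1]
  abel

/-- Global existence for a globally Lipschitz right-hand side. -/
theorem exists_isForwardSolution (hF : Continuous fun p : ℝ × E => F p.1 p.2) (hK : 0 < K)
    (hL : ∀ t y₁ y₂, ‖F t y₁ - F t y₂‖ ≤ K * ‖y₁ - y₂‖) (y₀ : E) :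
    ∃ u : ℝ → E, IsForwardSolution F y₀ u ∧
      ∀ t, 0 ≤ t → Tendsto (fun k => picardIterate F y₀ k t) atTop (𝓝 (u t)) := by
  have hstep : ∀ T, 0 ≤ T → ∃ C, ∀ t ∈ Icc 0 T, ∀ k,
      dist (picardIterate F y₀ k t) (picardIterate F y₀ (k + 1) t) ≤ C * (1 / 2) ^ k := by
    intro T hT
    obtain ⟨M, hM⟩ := (isCompact_Icc (a := (0 : ℝ)) (b := T)).exists_bound_of_continuousOn
      ((continuous_picardIterate hF y₀ 1).sub continuous_const).continuousOn
    have h0 : 0 ≤ M := (norm_nonneg _).trans (hM 0 ⟨le_rfl, hT⟩)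
    refine ⟨M * Real.exp (2 * K * T), fun t ht k => ?_⟩
    rw [dist_comm, dist_eq_norm]
    refine (norm_picardIterate_sub_le hF hK hL hM k t ht).trans ?_
    rw [mul_right_comm]
    gcongr
    exact ht.2
  have hlim : ∀ t, ∃ v, 0 ≤ t → Tendsto (fun k => picardIterate F y₀ k t) atTop (𝓝 v) := by
    intro t
    by_cases ht : 0 ≤ t
    · obtain ⟨C, hC⟩ := hstep t ht
      obtain ⟨v, hv⟩ := cauchySeq_tendsto_of_complete
        (cauchySeq_of_le_geometric _ _ (by norm_num) (hC t ⟨ht, le_rfl⟩))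
      exact ⟨v, fun _ => hv⟩
    · exact ⟨0, fun h => absurd h ht⟩
  choose u hu using hlim
  have hunif : ∀ T, 0 ≤ T → TendstoUniformlyOn (picardIterate F y₀) u atTop (Icc 0 T) := by
    intro T hT
    obtain ⟨C, hC⟩ := hstep T hT
    have h0 : Tendsto (fun k : ℕ => C * (1 / 2 : ℝ) ^ k / (1 - 1 / 2)) atTop (𝓝 0) := by
      simpa using ((tendsto_pow_atTop_nhds_zero_of_lt_one (by norm_num)
        (by norm_num : (1 / 2 : ℝ) < 1)).const_mul C).div_const (1 - 1 / 2)
    rw [Metric.tendstoUniformlyOn_iff]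
    intro δ hδ
    filter_upwards [h0.eventually_lt_const hδ] with k hk t ht
    rw [dist_comm]
    exact (dist_le_of_le_geometric_of_tendsto _ _ (by norm_num) (hC t ht) (hu t ht.1) k).trans_lt hk
  have hcontT : ∀ T, 0 ≤ T → ContinuousOn u (Icc 0 T) := fun T hT =>
    (hunif T hT).continuousOn
      (Eventually.of_forall fun k => (continuous_picardIterate hF y₀ k).continuousOn).frequently
  have hcont : ContinuousOn u (Ici 0) := by
    intro t ht
    have ht' : (0 : ℝ) ≤ t := ht
    refine (hcontT (t + 1) (by linarith) t ⟨ht, by linarith⟩).mono_of_mem_nhdsWithin ?_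
    rw [← Ici_inter_Iic]
    exact inter_mem_nhdsWithin _ (Iic_mem_nhds (by linarith))
  refine ⟨u, isForwardSolution_of_integral hF hcont fun t ht => ?_, hu⟩
  refine tendsto_nhds_unique ((hu t ht).comp (tendsto_add_atTop_nat 1)) ?_
  refine Tendsto.const_add y₀ ?_
  obtain ⟨C, hC⟩ := hstep t ht
  have hFu : ContinuousOn (fun s => F s (u s)) (Icc 0 t) :=
    hF.comp_continuousOn (continuousOn_id.prodMk (hcontT t ht))
  obtain ⟨M, hM⟩ := isCompact_Icc.exists_bound_of_continuousOn hFu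
  have hC0 : 0 ≤ C := by simpa using dist_nonneg.trans (hC 0 ⟨le_rfl, ht⟩ 0)
  -- `M` bounds the field along the limit, the geometric series bounds the distance of any iterate
  -- from the limit by `C * 2`, and `K` is the Lipschitz constant.
  refine intervalIntegral.tendsto_integral_filter_of_dominated_convergence
    (fun _ => M + K * (C * 2)) (Eventually.of_forall fun k => ?_)
    (Eventually.of_forall fun k => Eventually.of_forall fun s hs => ?_)
    intervalIntegrable_const (Eventually.of_forall fun s hs => ?_)
  · exact (hF.comp (continuous_id.prodMk
      (continuous_picardIterate hF y₀ k))).aestronglyMeasurable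
  · rw [uIoc_of_le ht] at hs
    have hs' : s ∈ Icc 0 t := ⟨hs.1.le, hs.2⟩
    have h1 := dist_le_of_le_geometric_of_tendsto _ _ (by norm_num) (hC s hs') (hu s hs'.1) k
    rw [dist_eq_norm] at h1
    have h2 : C * (1 / 2 : ℝ) ^ k / (1 - 1 / 2) ≤ C * 2 := by
      have : (1 / 2 : ℝ) ^ k ≤ 1 := pow_le_one₀ (by norm_num) (by norm_num)
      rw [div_le_iff₀ (by norm_num)]
      nlinarith
    have h3 := hL s (picardIterate F y₀ k s) (u s)
    have h4 := norm_sub_norm_le (F s (picardIterate F y₀ k s)) (F s (u s))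
    have h5 := hM s hs'
    have h6 := mul_le_mul_of_nonneg_left (h1.trans h2) hK.le
    linarith
  · rw [uIoc_of_le ht] at hs
    have hcs : Continuous (F s) := hF.comp (continuous_const.prodMk continuous_id)
    exact (hcs.tendsto _).comp (hu s hs.1.le)

end GlobalODE

/-! ### Measurable dependence of the Picard iterates on a parameter -/

section Measurability

variable {E : Type*} [NormedAddCommGroup E] [NormedSpace ℝ E] [MeasurableSpace E]
  [BorelSpace E] [SecondCountableTopology E]
  {Ω : Type*} [MeasurableSpace Ω]

theorem measurable_intervalIntegral {G : Ω → ℝ → E}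
    (hG : Measurable fun p : Ω × ℝ => G p.1 p.2) (a b : ℝ) :
    Measurable fun ω => ∫ s in a..b, G ω s := by
  simp only [intervalIntegral]
  exact (hG.stronglyMeasurable.integral_prod_right').measurable.sub
    (hG.stronglyMeasurable.integral_prod_right').measurable

/-- The next iterate integrates the previous one in time, so the induction needs joint measurability
in time and `ω`; continuity in time supplies it. -/
theorem measurable_picardIterate {F : Ω → ℝ → E → E}
    (hF : ∀ ω, Continuous fun p : ℝ × E => F ω p.1 p.2)
    (hFm : Measurable fun p : Ω × ℝ × E => F p.1 p.2.1 p.2.2) (y₀ : E) (k : ℕ) (t : ℝ) :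
    Measurable fun ω => picardIterate (F ω) y₀ k t := by
  induction k generalizing t with
  | zero => exact measurable_const
  | succ k ih =>
    have h := measurable_uncurry_of_continuous_of_measurable
      (u := fun (t : ℝ) ω => picardIterate (F ω) y₀ k t)
      (fun ω => continuous_picardIterate (hF ω) y₀ k) ih
    refine measurable_const.add (measurable_intervalIntegral ?_ 0 t)
    exact hFm.comp (measurable_fst.prodMk (measurable_snd.prodMk (h.comp measurable_swap)))

end Measurability

/-! ### Differential inequalities -/

section Comparison

/-- A linear differential inequality with a source. -/
theorem exp_mul_le_of_hasDerivWithinAt {v v' G h : ℝ → ℝ} {a : ℝ}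
    (hv : ∀ t, 0 ≤ t → HasDerivWithinAt v (v' t) (Ici 0) t)
    (hG : ∀ t, HasDerivAt G (Real.exp (a * t) * h t) t)
    (hle : ∀ t, 0 ≤ t → v' t ≤ -a * v t + h t) {t : ℝ} (ht : 0 ≤ t) :
    Real.exp (a * t) * v t ≤ v 0 + (G t - G 0) := by
  -- With the integrating factor and the primitive `G` of the weighted source, the inequality says
  -- that this function does not increase.
  have hd : ∀ t, 0 ≤ t → HasDerivWithinAt (fun t => Real.exp (a * t) * v t - G t)
      (Real.exp (a * t) * (a * v t + v' t - h t)) (Ici 0) t := by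
    intro t ht
    have h1 : HasDerivAt (fun t : ℝ => Real.exp (a * t)) (Real.exp (a * t) * a) t := by
      simpa using ((hasDerivAt_id t).const_mul a).exp
    convert! (h1.hasDerivWithinAt.mul (hv t ht)).sub (hG t).hasDerivWithinAt using 1
    ring
  have hanti : AntitoneOn (fun t => Real.exp (a * t) * v t - G t) (Ici 0) := by
    refine antitoneOn_of_hasDerivWithinAt_nonpos (convex_Ici 0)
      (fun t ht => (hd t ht).continuousWithinAt)
      (fun t ht => (hd t (interior_subset ht)).mono interior_subset) fun t ht => ?_
    refine mul_nonpos_of_nonneg_of_nonpos (Real.exp_pos _).le ?_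
    linarith [hle t (interior_subset ht)]
  have := hanti self_mem_Ici ht ht
  simp only [mul_zero, Real.exp_zero, one_mul] at this
  linarith

variable {E : Type*} [NormedAddCommGroup E] [InnerProductSpace ℝ E]

/-- The squared distance decays at rate `2 * κ` by the one-sided Lipschitz bound. This gives
uniqueness as well as contraction. -/
theorem IsForwardSolution.norm_sub_le {F : ℝ → E → E} {κ : ℝ}
    (hF : ∀ t y₁ y₂, inner ℝ (F t y₁ - F t y₂) (y₁ - y₂) ≤ -κ * ‖y₁ - y₂‖ ^ 2)
    {y₁ y₂ : E} {u₁ u₂ : ℝ → E} (h₁ : IsForwardSolution F y₁ u₁)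
    (h₂ : IsForwardSolution F y₂ u₂) {t : ℝ} (ht : 0 ≤ t) :
    ‖u₁ t - u₂ t‖ ≤ Real.exp (-κ * t) * ‖y₁ - y₂‖ := by
  have h := exp_mul_le_of_hasDerivWithinAt (v := fun t => ‖u₁ t - u₂ t‖ ^ 2) (a := 2 * κ)
    (h := fun _ => 0) (G := fun _ => 0)
    (fun t ht => ((h₁.2 t ht).sub (h₂.2 t ht)).norm_sq)
    (fun t => by simpa using hasDerivAt_const t (0 : ℝ))
    (fun t _ => by
      have := hF t (u₁ t) (u₂ t)
      rw [real_inner_comm] at this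
      simp only [Pi.sub_apply]
      linarith) ht
  rw [h₁.1, h₂.1, sub_self, add_zero] at h
  refine le_of_sq_le_sq ?_ (by positivity)
  have e : (Real.exp (-κ * t) * ‖y₁ - y₂‖) ^ 2 =
      Real.exp (-(2 * κ * t)) * ‖y₁ - y₂‖ ^ 2 := by
    rw [mul_pow, ← Real.exp_nat_mul]; congr 2; push_cast; ring
  rw [e, Real.exp_neg, inv_mul_eq_div, le_div_iff₀ (Real.exp_pos _), mul_comm]
  exact h

end Comparison

/-! ### The cocycles of the fast equation -/

section FastDynamics

/-- The standing assumptions on the linear part and the nonlinearity of the fast equation. -/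
structure IsDissipativePair {m n : ℕ} (A : Vec m →L[ℝ] Vec m) (g : Vec n → Vec m → Vec m)
    (lam L : ℝ) : Prop where
  coercive : ∀ y, lam * ‖y‖ ^ 2 ≤ inner ℝ (A y) y
  pos : 0 < L
  lt : L < lam
  lipschitz : ∀ x₁ x₂ y₁ y₂, ‖g x₁ y₁ - g x₂ y₂‖ ≤ L * (‖x₁ - x₂‖ + ‖y₁ - y₂‖)

/-- The right-hand side of the random differential equation. -/
noncomputable def fastField {m n : ℕ} {η : ℝ} (A : Vec m →L[ℝ] Vec m)
    (g : Vec n → Vec m → Vec m) (ε : ℝ) (x : Vec n) (ω : PathSpace m η) (t : ℝ) (y : Vec m) :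
    Vec m :=
  (1 / ε) • (-A y + g x (y + ou A ε (shiftEps ε t ω)))

variable {m n : ℕ} {η : ℝ} {A : Vec m →L[ℝ] Vec m} {g : Vec n → Vec m → Vec m} {lam L ε : ℝ}

theorem isTransformedSolution_iff {x : Vec n} {ω : PathSpace m η} {y₀ : Vec m} {u : ℝ → Vec m} :
    IsTransformedSolution A g ε x ω y₀ u ↔ IsForwardSolution (fastField A g ε x ω) y₀ u := Iff.rfl

namespace IsDissipativePair

theorem lam_pos (h : IsDissipativePair A g lam L) : 0 < lam := h.pos.trans h.lt

theorem continuous_right (h : IsDissipativePair A g lam L) (x : Vec n) : Continuous (g x) :=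
  (LipschitzWith.of_dist_le_mul (K := L.toNNReal) fun y₁ y₂ => by
    rw [Real.coe_toNNReal _ h.pos.le, dist_eq_norm, dist_eq_norm]
    simpa using h.lipschitz x x y₁ y₂).continuous

theorem continuous_fastField (h : IsDissipativePair A g lam L) (hε : 0 < ε) (x : Vec n)
    (ω : PathSpace m η) : Continuous fun p : ℝ × Vec m => fastField A g ε x ω p.1 p.2 := by
  have hZ := (continuous_ou_shiftEps h.coercive h.lam_pos hε ω).comp
    (continuous_fst (X := ℝ) (Y := Vec m))
  exact ((A.continuous.comp continuous_snd).neg.add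
    ((h.continuous_right x).comp (continuous_snd.add hZ))).const_smul (1 / ε)

theorem fastField_sub (x₁ x₂ : Vec n) (ω : PathSpace m η) (t : ℝ) (y₁ y₂ : Vec m) :
    fastField A g ε x₁ ω t y₁ - fastField A g ε x₂ ω t y₂ = (1 / ε) • (-A (y₁ - y₂) +
      (g x₁ (y₁ + ou A ε (shiftEps ε t ω)) - g x₂ (y₂ + ou A ε (shiftEps ε t ω)))) := by
  rw [fastField, fastField, ← smul_sub, map_sub]
  congr 1
  abel

theorem norm_fastField_sub_le (h : IsDissipativePair A g lam L) (hε : 0 < ε) (x : Vec n)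
    (ω : PathSpace m η) (t : ℝ) (y₁ y₂ : Vec m) :
    ‖fastField A g ε x ω t y₁ - fastField A g ε x ω t y₂‖ ≤ (‖A‖ + L) / ε * ‖y₁ - y₂‖ := by
  rw [fastField_sub, norm_smul, Real.norm_of_nonneg (by positivity)]
  have h1 := h.lipschitz x x (y₁ + ou A ε (shiftEps ε t ω)) (y₂ + ou A ε (shiftEps ε t ω))
  simp only [sub_self, norm_zero, zero_add, add_sub_add_right_eq_sub] at h1
  calc _ ≤ 1 / ε * (‖A‖ * ‖y₁ - y₂‖ + L * ‖y₁ - y₂‖) := by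
        gcongr
        refine (norm_add_le _ _).trans (add_le_add ?_ h1)
        rw [norm_neg]
        exact A.le_opNorm _
    _ = _ := by ring

/-- The linear part dissipates at rate `lam`, the nonlinearity gives back at most `L`, and the
common shift by `ou` cancels. Equal parameters yield contraction, different ones the dependence on
`x`. -/
theorem inner_fastField_sub_le (h : IsDissipativePair A g lam L) (hε : 0 < ε) (x₁ x₂ : Vec n)
    (ω : PathSpace m η) (t : ℝ) (y₁ y₂ : Vec m) :
    inner ℝ (fastField A g ε x₁ ω t y₁ - fastField A g ε x₂ ω t y₂) (y₁ - y₂) ≤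
      -((lam - L) / ε) * ‖y₁ - y₂‖ ^ 2 + L / ε * ‖x₁ - x₂‖ * ‖y₁ - y₂‖ := by
  rw [fastField_sub, real_inner_smul_left, inner_add_left, inner_neg_left]
  have h1 := h.lipschitz x₁ x₂ (y₁ + ou A ε (shiftEps ε t ω)) (y₂ + ou A ε (shiftEps ε t ω))
  rw [add_sub_add_right_eq_sub] at h1
  have h2 := h.coercive (y₁ - y₂)
  have h3 := (real_inner_le_norm (g x₁ (y₁ + ou A ε (shiftEps ε t ω)) -
    g x₂ (y₂ + ou A ε (shiftEps ε t ω))) (y₁ - y₂)).trans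
    (mul_le_mul_of_nonneg_right h1 (norm_nonneg _))
  calc _ ≤ 1 / ε * (-(lam * ‖y₁ - y₂‖ ^ 2) +
        L * (‖x₁ - x₂‖ + ‖y₁ - y₂‖) * ‖y₁ - y₂‖) := by gcongr
    _ = _ := by ring

theorem inner_fastField_sub_self_le (h : IsDissipativePair A g lam L) (hε : 0 < ε) (x : Vec n)
    (ω : PathSpace m η) (t : ℝ) (y₁ y₂ : Vec m) :
    inner ℝ (fastField A g ε x ω t y₁ - fastField A g ε x ω t y₂) (y₁ - y₂) ≤
      -((lam - L) / ε) * ‖y₁ - y₂‖ ^ 2 := by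
  simpa using h.inner_fastField_sub_le hε x x ω t y₁ y₂

theorem measurable_fastField (h : IsDissipativePair A g lam L) (x : Vec n) :
    Measurable fun p : PathSpace m η × ℝ × Vec m => fastField A g ε x p.1 p.2.1 p.2.2 := by
  have hZ : Measurable fun p : PathSpace m η × ℝ × Vec m => ou A ε (shiftEps ε p.2.1 p.1) :=
    (measurable_ou A ε).comp (measurable_uncurry_shift.comp
      ((measurable_snd.fst.div_const ε).prodMk measurable_fst))
  exact ((A.measurable.comp measurable_snd.snd).neg.add
    ((h.continuous_right x).measurable.comp (measurable_snd.snd.add hZ))).const_smul (1 / ε)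

theorem lipschitz_const_pos (h : IsDissipativePair A g lam L) (hε : 0 < ε) :
    0 < (‖A‖ + L) / ε := by
  have := h.pos
  positivity

theorem phiTilde_spec (h : IsDissipativePair A g lam L) (hε : 0 < ε) (x : Vec n)
    (ω : PathSpace m η) (y₀ : Vec m) :
    IsTransformedSolution A g ε x ω y₀ (fun t => phiTilde A g ε x t.toNNReal ω y₀) := by
  have hex : ∃ u : ℝ → Vec m, IsTransformedSolution A g ε x ω y₀ u := by
    obtain ⟨u, hu, _⟩ := exists_isForwardSolution (h.continuous_fastField hε x ω)
      (h.lipschitz_const_pos hε) (h.norm_fastField_sub_le hε x ω) y₀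
    exact ⟨u, hu⟩
  have heq : ∀ t : ℝ, 0 ≤ t → phiTilde A g ε x t.toNNReal ω y₀ = hex.choose t := fun t ht => by
    rw [phiTilde, dif_pos hex, Real.coe_toNNReal _ ht]
  refine ⟨(heq 0 le_rfl).trans hex.choose_spec.1, fun t ht => ?_⟩
  simp only [heq t ht]
  exact (hex.choose_spec.2 t ht).congr_of_mem (fun s hs => heq s hs) ht

theorem isForwardSolution_phiTilde (h : IsDissipativePair A g lam L) (hε : 0 < ε) (x : Vec n)
    (ω : PathSpace m η) (y₀ : Vec m) :
    IsForwardSolution (fastField A g ε x ω) y₀ (fun t => phiTilde A g ε x t.toNNReal ω y₀) :=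
  isTransformedSolution_iff.1 (h.phiTilde_spec hε x ω y₀)

theorem eq_phiTilde (h : IsDissipativePair A g lam L) (hε : 0 < ε) {x : Vec n}
    {ω : PathSpace m η} {y₀ : Vec m} {u : ℝ → Vec m} (hu : IsTransformedSolution A g ε x ω y₀ u)
    (t : ℝ≥0) : u t = phiTilde A g ε x t ω y₀ := by
  have := IsForwardSolution.norm_sub_le (h.inner_fastField_sub_self_le hε x ω)
    (isTransformedSolution_iff.1 hu) (h.isForwardSolution_phiTilde hε x ω y₀) t.2
  simpa [sub_eq_zero] using this

theorem norm_phiTilde_sub_le (h : IsDissipativePair A g lam L) (hε : 0 < ε) (x : Vec n)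
    (t : ℝ≥0) (ω : PathSpace m η) (y₁ y₂ : Vec m) :
    ‖phiTilde A g ε x t ω y₁ - phiTilde A g ε x t ω y₂‖ ≤
      Real.exp (-((lam - L) / ε) * t) * ‖y₁ - y₂‖ := by
  simpa using IsForwardSolution.norm_sub_le (h.inner_fastField_sub_self_le hε x ω)
    (h.isForwardSolution_phiTilde hε x ω y₁) (h.isForwardSolution_phiTilde hε x ω y₂) t.2

theorem phiTilde_zero (h : IsDissipativePair A g lam L) (hε : 0 < ε) (x : Vec n)
    (ω : PathSpace m η) (y : Vec m) : phiTilde A g ε x 0 ω y = y := by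
  simpa using (h.phiTilde_spec hε x ω y).1

/-- The tail of a solution after time `τ` solves the equation over the shifted path; uniqueness
identifies it. -/
theorem phiTilde_add (h : IsDissipativePair A g lam L) (hε : 0 < ε) (x : Vec n) (t τ : ℝ≥0)
    (ω : PathSpace m η) (y : Vec m) :
    phiTilde A g ε x (t + τ) ω y =
      phiTilde A g ε x t (shiftEps ε τ ω) (phiTilde A g ε x τ ω y) := by
  have hsol := h.phiTilde_spec hε x ω y
  have hshift : IsTransformedSolution A g ε x (shiftEps ε τ ω) (phiTilde A g ε x τ ω y)
      (fun t => phiTilde A g ε x (t + τ).toNNReal ω y) := by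
    refine ⟨by simp, fun t ht => ?_⟩
    have h1 := hsol.2 (t + τ) (by positivity)
    have h2 : HasDerivWithinAt (fun t : ℝ => t + τ) 1 (Ici 0) t :=
      ((hasDerivAt_id t).add_const (τ : ℝ)).hasDerivWithinAt
    have h3 := h1.scomp t h2 (fun s hs => add_nonneg hs τ.2)
    have e : shiftEps ε t (shiftEps ε τ ω) = shiftEps ε (t + τ) ω := by
      simp [shiftEps, shift_shift, add_div]
    rw [one_smul] at h3
    rw [e]
    exact h3
  have := h.eq_phiTilde hε hshift t
  rwa [← NNReal.coe_add, Real.toNNReal_coe] at this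

/-- Running the unscaled solution at time `t / ε` produces the factor `1 / ε` by the chain rule, and
the noise term rescales by `ou_shiftEps`; uniqueness does the rest. -/
theorem phiTilde_eq_one (h : IsDissipativePair A g lam L) (hε : 0 < ε) (x : Vec n) (t : ℝ≥0)
    (ω : PathSpace m η) (y : Vec m) :
    phiTilde A g ε x t ω y = phiTilde A g 1 x (t / ε).toNNReal ω y := by
  have hsol := h.phiTilde_spec one_pos x ω y
  have hscale : IsTransformedSolution A g ε x ω y
      (fun t => phiTilde A g 1 x (t / ε).toNNReal ω y) := by
    refine ⟨by simpa using hsol.1, fun t ht => ?_⟩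
    have h1 := hsol.2 (t / ε) (by positivity)
    have h2 : HasDerivWithinAt (fun t : ℝ => t / ε) (1 / ε) (Ici 0) t :=
      ((hasDerivAt_id t).div_const ε).hasDerivWithinAt
    have h3 := h1.scomp t h2 (fun s hs => div_nonneg hs hε.le)
    rw [ou_shiftEps A hε]
    simp only [shiftEps, div_one, one_smul] at h3
    exact h3
  exact (h.eq_phiTilde hε hscale t).symm

theorem continuous_phiTilde_time (h : IsDissipativePair A g lam L) (hε : 0 < ε) (x : Vec n)
    (ω : PathSpace m η) (y : Vec m) : Continuous fun t : ℝ≥0 => phiTilde A g ε x t ω y := by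
  have := (h.isForwardSolution_phiTilde hε x ω y).continuousOn.comp_continuous
    NNReal.continuous_coe (fun t => t.2)
  simpa [Function.comp_def] using this

/-- For fixed time and state the solution is a limit of Picard iterates, hence measurable in `ω`.
For fixed `ω` it is continuous in time and 1-Lipschitz in the state, hence jointly continuous. Such
a Carathéodory function is jointly measurable. -/
theorem measurable_phiTilde (h : IsDissipativePair A g lam L) (hε : 0 < ε) (x : Vec n) :
    Measurable fun p : ℝ≥0 × PathSpace m η × Vec m => phiTilde A g ε x p.1 p.2.1 p.2.2 := by
  have hm : ∀ q : ℝ≥0 × Vec m, Measurable fun ω : PathSpace m η => phiTilde A g ε x q.1 ω q.2 := by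
    intro q
    refine measurable_of_tendsto_metrizable (f := fun (k : ℕ) (ω : PathSpace m η) =>
      picardIterate (fastField A g ε x ω) q.2 k q.1) (fun k => measurable_picardIterate
        (fun ω => h.continuous_fastField hε x ω) (h.measurable_fastField x) q.2 k q.1)
      (tendsto_pi_nhds.2 fun ω => ?_)
    obtain ⟨u, hu, hlim⟩ := exists_isForwardSolution (h.continuous_fastField hε x ω)
      (h.lipschitz_const_pos hε) (h.norm_fastField_sub_le hε x ω) q.2
    rw [← h.eq_phiTilde hε hu q.1]
    exact hlim _ q.1.2
  have hcont : ∀ ω : PathSpace m η,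
      Continuous fun q : ℝ≥0 × Vec m => phiTilde A g ε x q.1 ω q.2 := by
    intro ω
    refine continuous_prod_of_continuous_lipschitzWith'
      (fun q : ℝ≥0 × Vec m => phiTilde A g ε x q.1 ω q.2) 1 (fun t => ?_)
      (fun y => h.continuous_phiTilde_time hε x ω y)
    refine LipschitzWith.of_dist_le_mul fun y₁ y₂ => ?_
    rw [dist_eq_norm, dist_eq_norm, NNReal.coe_one]
    refine (h.norm_phiTilde_sub_le hε x t ω y₁ y₂).trans ?_
    gcongr
    refine Real.exp_le_one_iff.2 ?_
    have : 0 ≤ (lam - L) / ε * t :=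
      mul_nonneg (div_nonneg (sub_nonneg.2 h.lt.le) hε.le) t.2
    linarith
  have := measurable_uncurry_of_continuous_of_measurable
    (u := fun (q : ℝ≥0 × Vec m) (ω : PathSpace m η) => phiTilde A g ε x q.1 ω q.2) hcont hm
  exact this.comp ((measurable_fst.prodMk measurable_snd.snd).prodMk measurable_snd.fst)

theorem isRDS_phiTilde (h : IsDissipativePair A g lam L) (hε : 0 < ε) (x : Vec n)
    {P : Measure (PathSpace m η)} (hP : IsMetricDS (shiftEps ε) P) :
    IsRDS (shiftEps ε) P (phiTilde A g ε x) where
  base := hP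
  measurable := h.measurable_phiTilde hε x
  zero := h.phiTilde_zero hε x
  cocycle := h.phiTilde_add hε x

theorem isRDS_phi (h : IsDissipativePair A g lam L) (hε : 0 < ε) (x : Vec n)
    {P : Measure (PathSpace m η)} (hP : IsMetricDS (shiftEps ε) P) :
    IsRDS (shiftEps ε) P (phi A g ε x) where
  base := hP
  measurable := by
    have h1 : Measurable fun p : ℝ≥0 × PathSpace m η × Vec m => shiftEps ε p.1 p.2.1 :=
      hP.measurable.comp (measurable_fst.coe_nnreal_real.prodMk measurable_snd.fst)
    have h2 : Measurable fun p : ℝ≥0 × PathSpace m η × Vec m => p.2.2 - ou A ε p.2.1 :=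
      measurable_snd.snd.sub ((measurable_ou A ε).comp measurable_snd.fst)
    exact ((h.measurable_phiTilde hε x).comp
      (measurable_fst.prodMk (measurable_snd.fst.prodMk h2))).add ((measurable_ou A ε).comp h1)
  zero ω y := by
    simp only [phi, conj, conjInv, h.phiTilde_zero hε]
    rw [NNReal.coe_zero, hP.zero, sub_add_cancel]
  cocycle t τ ω y := by
    simp only [phi, conj, conjInv, h.phiTilde_add hε, add_sub_cancel_right]
    rw [NNReal.coe_add, hP.add]

theorem norm_phi_sub_le (h : IsDissipativePair A g lam L) (hε : 0 < ε) (x : Vec n)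
    (t : ℝ≥0) (ω : PathSpace m η) (y₁ y₂ : Vec m) :
    ‖phi A g ε x t ω y₁ - phi A g ε x t ω y₂‖ ≤
      Real.exp (-((lam - L) / ε) * t) * ‖y₁ - y₂‖ := by
  simpa [phi, conj, conjInv] using
    h.norm_phiTilde_sub_le hε x t ω (y₁ - ou A ε ω) (y₂ - ou A ε ω)

/-- Eliminating the driver by means of the Ornstein-Uhlenbeck equation converts one integral
equation into the other. Since `u` is any continuous function, this serves both directions of the
conjugation. -/
theorem fast_integral_eq (h : IsDissipativePair A g lam L) (hε : 0 < ε) (x : Vec n)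
    (ω : PathSpace m η) {u : ℝ → Vec m} (hu : ContinuousOn u (Ici 0)) {t : ℝ} (ht : 0 ≤ t) :
    (1 / ε) • (∫ r in (0 : ℝ)..t, (-A (u r) + g x (u r))) + driver ε ω t =
      (∫ r in (0 : ℝ)..t, fastField A g ε x ω r (u r - ou A ε (shiftEps ε r ω))) +
        ou A ε (shiftEps ε t ω) - ou A ε ω := by
  have hZ := ou_shiftEps_sub h.coercive h.lam_pos hε ω 0 t
  have hZc := continuous_ou_shiftEps h.coercive h.lam_pos hε ω
  have e0 : shiftEps ε 0 ω = ω := by simp [shiftEps, shift_zero]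
  have d0 : driver ε ω 0 = 0 := by simp [driver, ω.2.1]
  have hu' : ContinuousOn u (Icc 0 t) := hu.mono Icc_subset_Ici_self
  have hint : IntervalIntegrable (fun r => -A (u r) + g x (u r)) volume 0 t :=
    ((A.continuous.comp_continuousOn hu').neg.add
      ((h.continuous_right x).comp_continuousOn hu')).intervalIntegrable_of_Icc ht
  have e : ∫ r in (0 : ℝ)..t, fastField A g ε x ω r (u r - ou A ε (shiftEps ε r ω)) =
      (1 / ε) • (∫ r in (0 : ℝ)..t, (-A (u r) + g x (u r))) +
        (1 / ε) • (∫ r in (0 : ℝ)..t, A (ou A ε (shiftEps ε r ω))) := by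
    have hint' : IntervalIntegrable (fun r => A (ou A ε (shiftEps ε r ω))) volume 0 t :=
      (A.continuous.comp hZc).intervalIntegrable _ _
    rw [← smul_add, ← intervalIntegral.integral_add hint hint', ← intervalIntegral.integral_smul]
    refine intervalIntegral.integral_congr fun r _ => ?_
    simp only [fastField, map_sub, sub_add_cancel]
    congr 1
    abel
  rw [e, hZ, e0, d0]
  abel

theorem isTransformedSolution_sub_ou (h : IsDissipativePair A g lam L) (hε : 0 < ε) {x : Vec n}
    {ω : PathSpace m η} {y₀ : Vec m} {u : ℝ → Vec m} (hu : IsFastSolution A g ε x ω y₀ u) :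
    IsTransformedSolution A g ε x ω (y₀ - ou A ε ω)
      (fun t => u t - ou A ε (shiftEps ε t ω)) := by
  have hZc := continuous_ou_shiftEps h.coercive h.lam_pos hε ω
  refine isForwardSolution_of_integral (h.continuous_fastField hε x ω)
    (hu.1.sub hZc.continuousOn) fun t ht => ?_
  simp only [Pi.sub_apply]
  rw [hu.2 t ht, add_assoc, h.fast_integral_eq hε x ω hu.1 ht]
  abel

theorem phi_toNNReal_eq (x : Vec n) (ω : PathSpace m η) (y₀ : Vec m) {t : ℝ} (ht : 0 ≤ t) :
    phi A g ε x t.toNNReal ω y₀ = phiTilde A g ε x t.toNNReal ω (y₀ - ou A ε ω) +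
      ou A ε (shiftEps ε t ω) := by
  simp [phi, conj, conjInv, ht]

theorem phi_spec (h : IsDissipativePair A g lam L) (hε : 0 < ε) (x : Vec n)
    (ω : PathSpace m η) (y₀ : Vec m) :
    IsFastSolution A g ε x ω y₀ (fun t => phi A g ε x t.toNNReal ω y₀) := by
  have hZc := continuous_ou_shiftEps h.coercive h.lam_pos hε ω
  have hsol := h.isForwardSolution_phiTilde hε x ω (y₀ - ou A ε ω)
  have hc : ContinuousOn (fun t : ℝ => phi A g ε x t.toNNReal ω y₀) (Ici 0) :=
    (hsol.continuousOn.add hZc.continuousOn).congr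
      fun t ht => phi_toNNReal_eq x ω y₀ ht
  refine ⟨hc, fun t ht => ?_⟩
  rw [add_assoc, h.fast_integral_eq hε x ω hc ht]
  beta_reduce
  rw [phi_toNNReal_eq x ω y₀ ht,
    hsol.eq_integral (h.continuous_fastField hε x ω) ht]
  have e : ∫ r in (0 : ℝ)..t, fastField A g ε x ω r
        (phi A g ε x r.toNNReal ω y₀ - ou A ε (shiftEps ε r ω)) =
      ∫ r in (0 : ℝ)..t, fastField A g ε x ω r
        (phiTilde A g ε x r.toNNReal ω (y₀ - ou A ε ω)) := by
    refine intervalIntegral.integral_congr fun r hr => ?_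
    rw [uIcc_of_le ht] at hr
    simp only [phi_toNNReal_eq x ω y₀ hr.1, add_sub_cancel_right]
  rw [e]
  abel

theorem eqOn_phi (h : IsDissipativePair A g lam L) (hε : 0 < ε) {x : Vec n}
    {ω : PathSpace m η} {y₀ : Vec m} {u : ℝ → Vec m} (hu : IsFastSolution A g ε x ω y₀ u) :
    EqOn u (fun t => phi A g ε x t.toNNReal ω y₀) (Ici 0) := by
  intro t ht
  have h1 := h.eq_phiTilde hε (h.isTransformedSolution_sub_ou hε hu) t.toNNReal
  rw [Real.coe_toNNReal _ ht] at h1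
  simp only
  rw [phi_toNNReal_eq x ω y₀ ht, ← h1, sub_add_cancel]

end IsDissipativePair

end FastDynamics

/-! ### Random closed balls as tempered random sets -/

section RandomBalls

theorem infDist_closedBall {E : Type*} [NormedAddCommGroup E] [NormedSpace ℝ E] {r : ℝ}
    (hr : 0 ≤ r) (c y : E) : Metric.infDist y (Metric.closedBall c r) = max (‖y - c‖ - r) 0 := by
  rw [← Metric.cthickening_singleton c hr, Metric.infDist, infEDist_cthickening,
    Metric.infEDist_singleton, edist_dist, ← ENNReal.ofReal_sub _ hr, ENNReal.toReal_ofReal',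
    dist_eq_norm]

/-- The norm is maximal at the point of the sphere in the direction of the centre, or in any
direction if the centre is `0`; a unit vector must exist for this. -/
theorem sSup_norm_closedBall {E : Type*} [NormedAddCommGroup E] [NormedSpace ℝ E] [Nontrivial E]
    {r : ℝ} (hr : 0 ≤ r) (c : E) :
    sSup ((fun y => ‖y‖) '' Metric.closedBall c r) = ‖c‖ + r := by
  obtain ⟨e, he, hce⟩ : ∃ e : E, ‖e‖ = 1 ∧ c = ‖c‖ • e := by
    by_cases hc : c = 0
    · obtain ⟨e, he⟩ := exists_norm_eq E zero_le_one
      exact ⟨e, he, by simp [hc]⟩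
    · have hc' : ‖c‖ ≠ 0 := norm_ne_zero_iff.2 hc
      exact ⟨‖c‖⁻¹ • c, by simp [norm_smul, hc'], by simp [smul_smul, hc']⟩
  refine IsGreatest.csSup_eq ⟨⟨c + r • e, ?_, ?_⟩, ?_⟩
  · simp [norm_smul, he, abs_of_nonneg hr]
  · beta_reduce
    nth_rewrite 1 [hce]
    rw [← add_smul, norm_smul, he, mul_one, Real.norm_of_nonneg (by positivity)]
  · rintro _ ⟨y, hy, rfl⟩
    rw [mem_closedBall_iff_norm] at hy
    calc ‖y‖ = ‖c + (y - c)‖ := by rw [add_sub_cancel]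
      _ ≤ ‖c‖ + r := (norm_add_le _ _).trans (by gcongr)

theorem isTemperedRandomSet_closedBall {Ω E : Type*} [MeasurableSpace Ω] [NormedAddCommGroup E]
    [NormedSpace ℝ E] [MeasurableSpace E] [BorelSpace E] [SecondCountableTopology E]
    {θ : ℝ → Ω → Ω} {c : Ω → E} {ρ : Ω → ℝ} (hc : Measurable c) (hρ : Measurable ρ)
    (hρ0 : ∀ ω, 0 ≤ ρ ω) (hgrowth : ∀ ω, ∃ K : ℝ, ∀ t, ‖c (θ t ω)‖ + ρ (θ t ω) ≤ K * (1 + |t|)) :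
    IsTemperedRandomSet θ (fun ω => Metric.closedBall (c ω) (ρ ω)) where
  nonempty ω := Metric.nonempty_closedBall.2 (hρ0 ω)
  closed ω := Metric.isClosed_closedBall
  measurable y := by
    simp only [infDist_closedBall (hρ0 _)]
    exact ((hc.const_sub y).norm.sub hρ).max measurable_const
  bounded ω := Metric.isBounded_closedBall
  tempered := by
    have hsum : IsTempered θ fun ω => ‖c ω‖ + ρ ω :=
      .of_linear_growth (hc.norm.add hρ) (fun ω => add_nonneg (norm_nonneg _) (hρ0 ω)) hgrowth
    -- In the zero space the supremum is `0` even when the radius is positive, so the formula for it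
    -- fails there.
    rcases subsingleton_or_nontrivial E with hE | hE
    · have e : ∀ ω, sSup ((fun y => ‖y‖) '' Metric.closedBall (c ω) (ρ ω)) = 0 := by
        intro ω
        have hne : (Metric.closedBall (c ω) (ρ ω)).Nonempty :=
          Metric.nonempty_closedBall.2 (hρ0 ω)
        have : (fun y : E => ‖y‖) = fun _ => 0 := by
          ext y; rw [Subsingleton.elim y 0, norm_zero]
        rw [this, hne.image_const, csSup_singleton]
      simp only [e]
      exact hsum.mono measurable_const (fun _ => le_rfl)
        (fun ω => add_nonneg (norm_nonneg _) (hρ0 ω))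
    · simpa only [sSup_norm_closedBall (hρ0 _)] using hsum

end RandomBalls

/-! ### The square radius as a solution of the comparison equation -/

section Radius

variable {m n : ℕ} {η : ℝ} {A : Vec m →L[ℝ] Vec m} {g : Vec n → Vec m → Vec m} {lam L ε μ : ℝ}

/-- The source term in the differential inequality for the square norm. -/
noncomputable def radiusSource (A : Vec m →L[ℝ] Vec m) (g : Vec n → Vec m → Vec m) (L : ℝ)
    (x : Vec n) (ω : PathSpace m η) : ℝ :=
  3 * L ^ 2 * ‖x‖ ^ 2 + 3 * L ^ 2 * ‖ou A 1 ω‖ ^ 2 + 3 * (max 1 L) ^ 2 * ‖g 0 0‖ ^ 2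

theorem radiusSource_nonneg (A : Vec m →L[ℝ] Vec m) (g : Vec n → Vec m → Vec m) (L : ℝ)
    (x : Vec n) (ω : PathSpace m η) : 0 ≤ radiusSource A g L x ω := by
  unfold radiusSource
  positivity

theorem radiusIntegrand_one (x : Vec n) (ω : PathSpace m η) (r : ℝ) :
    radiusIntegrand A g lam L μ 1 x ω r =
      Real.exp ((lam - L - μ) * r) * (1 / μ * radiusSource A g L x (shift r ω)) := by
  simp only [radiusIntegrand, radiusSource, shiftEps, div_one, one_mul]
  ring

theorem radiusIntegrand_eq_comp_div (hε : 0 < ε) (x : Vec n) (ω : PathSpace m η) (r : ℝ) :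
    radiusIntegrand A g lam L μ ε x ω r = 1 / ε * radiusIntegrand A g lam L μ 1 x ω (r / ε) := by
  rw [radiusIntegrand_one, radiusIntegrand, ou_shiftEps A hε, radiusSource, mul_div_assoc]
  ring

theorem radiusSq_eq_one (hε : 0 < ε) (x : Vec n) (ω : PathSpace m η) :
    radiusSq A g lam L μ ε x ω = radiusSq A g lam L μ 1 x ω := by
  simp only [radiusSq, radiusIntegrand_eq_comp_div hε]
  rw [integral_const_mul, integral_Iic_comp_div (radiusIntegrand A g lam L μ 1 x ω) hε,
    smul_eq_mul, ← mul_assoc (1 / ε), one_div_mul_cancel hε.ne', one_mul]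

theorem radiusSq_nonneg (hμ : 0 < μ) (x : Vec n) (ω : PathSpace m η) :
    0 ≤ radiusSq A g lam L μ 1 x ω := by
  refine mul_nonneg zero_le_two (integral_nonneg fun r => ?_)
  rw [radiusIntegrand_one]
  have := radiusSource_nonneg A g L x (shift r ω)
  positivity

theorem measurable_radiusSq (x : Vec n) :
    Measurable fun ω : PathSpace m η => radiusSq A g lam L μ 1 x ω := by
  have hZ : Measurable fun p : PathSpace m η × ℝ => ou A 1 (shift p.2 p.1) :=
    (measurable_ou A 1).comp (measurable_uncurry_shift.comp measurable_swap)
  have h : Measurable fun p : PathSpace m η × ℝ => radiusIntegrand A g lam L μ 1 x p.1 p.2 := by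
    simp only [radiusIntegrand_one, radiusSource]
    have h1 : Measurable fun p : PathSpace m η × ℝ => Real.exp ((lam - L - μ) * p.2) := by
      fun_prop
    exact h1.mul ((((hZ.norm.pow_const 2).const_mul (3 * L ^ 2)).const_add
      (3 * L ^ 2 * ‖x‖ ^ 2)).add_const _ |>.const_mul (1 / μ))
  exact (h.stronglyMeasurable.integral_prod_right'
    (ν := volume.restrict (Iic (0 : ℝ)))).measurable.const_mul 2

namespace IsDissipativePair

theorem continuous_radiusSource (h : IsDissipativePair A g lam L) (x : Vec n)
    (ω : PathSpace m η) : Continuous fun r : ℝ => radiusSource A g L x (shift r ω) := by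
  have hZ := continuous_ou_shift h.coercive h.lam_pos ω
  unfold radiusSource
  fun_prop

theorem exists_radiusSource_le (h : IsDissipativePair A g lam L) (x : Vec n)
    (ω : PathSpace m η) :
    ∃ K : ℝ, 0 ≤ K ∧ ∀ t, radiusSource A g L x (shift t ω) ≤ K * (1 + |t|) ^ 2 := by
  obtain ⟨K, hK, hle⟩ := exists_norm_ou_shift_le h.coercive h.lam_pos ω
  refine ⟨3 * L ^ 2 * ‖x‖ ^ 2 + 3 * L ^ 2 * K ^ 2 + 3 * (max 1 L) ^ 2 * ‖g 0 0‖ ^ 2,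
    by positivity, fun t => ?_⟩
  have h1 : 1 ≤ (1 + |t|) ^ 2 := one_le_pow₀ (by linarith [abs_nonneg t])
  have h2 : ‖ou A 1 (shift t ω)‖ ^ 2 ≤ K ^ 2 * (1 + |t|) ^ 2 := by
    rw [← mul_pow]
    exact pow_le_pow_left₀ (norm_nonneg _) (hle t) 2
  rw [radiusSource, add_mul, add_mul, mul_assoc (3 * L ^ 2) (K ^ 2)]
  exact add_le_add (add_le_add (le_mul_of_one_le_right (by positivity) h1)
    (mul_le_mul_of_nonneg_left h2 (by positivity))) (le_mul_of_one_le_right (by positivity) h1)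

theorem continuous_radiusIntegrand (h : IsDissipativePair A g lam L) (x : Vec n)
    (ω : PathSpace m η) : Continuous (radiusIntegrand A g lam L μ 1 x ω) := by
  have hq := h.continuous_radiusSource x ω
  have e : radiusIntegrand A g lam L μ 1 x ω = fun r => Real.exp ((lam - L - μ) * r) *
      (1 / μ * radiusSource A g L x (shift r ω)) := funext (radiusIntegrand_one x ω)
  rw [e]
  fun_prop

theorem integrableOn_radiusIntegrand_one (h : IsDissipativePair A g lam L) (hμ : 0 < μ)
    (hμlt : μ < lam - L) (x : Vec n) (ω : PathSpace m η) :
    IntegrableOn (radiusIntegrand A g lam L μ 1 x ω) (Iic 0) := by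
  obtain ⟨K, hK, hle⟩ := h.exists_radiusSource_le x ω
  refine integrableOn_Iic_of_norm_le (h.continuous_radiusIntegrand x ω)
    (sub_pos.2 hμlt) (K := 1 / μ * K) fun r _ => ?_
  have h0 := radiusSource_nonneg A g L x (shift r ω)
  rw [radiusIntegrand_one, Real.norm_of_nonneg (by positivity)]
  calc _ ≤ Real.exp ((lam - L - μ) * r) * (1 / μ * (K * (1 + |r|) ^ 2)) := by
        gcongr; exact hle r
    _ = _ := by ring

theorem integrableOn_radiusIntegrand (h : IsDissipativePair A g lam L) (hε : 0 < ε) (hμ : 0 < μ)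
    (hμlt : μ < lam - L) (x : Vec n) (ω : PathSpace m η) :
    IntegrableOn (radiusIntegrand A g lam L μ ε x ω) (Iic 0) := by
  have := (integrableOn_Iic_comp_div
    (h.integrableOn_radiusIntegrand_one hμ hμlt x ω) hε).const_mul (1 / ε)
  simp only [← radiusIntegrand_eq_comp_div hε] at this
  exact this

/-- Up to the integrating factor, the square radius along an orbit is the primitive from `-∞` of one
fixed function. So it is the stationary solution of the linear equation that bounds the squared norm
of a solution. -/
theorem exp_mul_radiusSq_shift (x : Vec n) (ω : PathSpace m η) (t : ℝ) :
    Real.exp ((lam - L - μ) * t) * radiusSq A g lam L μ 1 x (shift t ω) =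
      2 * ∫ r in Iic t, radiusIntegrand A g lam L μ 1 x ω r := by
  have e : ∀ r, radiusIntegrand A g lam L μ 1 x (shift t ω) r =
      Real.exp (-((lam - L - μ) * t)) * radiusIntegrand A g lam L μ 1 x ω (r + t) := by
    intro r
    rw [radiusIntegrand_one, radiusIntegrand_one, shift_shift,
      ← mul_assoc (Real.exp _) (Real.exp _), ← Real.exp_add]
    congr 2
    ring
  simp only [radiusSq, e]
  rw [integral_const_mul, integral_Iic_comp_add (radiusIntegrand A g lam L μ 1 x ω) t,
    Real.exp_neg]
  field_simp

/-- The inequality `1 + |r + t| ≤ (1 + |r|) * (1 + |t|)` separates the time of the shift from the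
integration variable. Quadratic growth of the square means linear growth of the radius. -/
theorem exists_radiusSq_le (h : IsDissipativePair A g lam L) (hμ : 0 < μ) (hμlt : μ < lam - L)
    (x : Vec n) (ω : PathSpace m η) :
    ∃ K : ℝ, 0 ≤ K ∧ ∀ t, radiusSq A g lam L μ 1 x (shift t ω) ≤ K * (1 + |t|) ^ 2 := by
  obtain ⟨K, hK, hle⟩ := h.exists_radiusSource_le x ω
  set c := lam - L - μ with hc
  have hc0 : 0 < c := sub_pos.2 hμlt
  set J := ∫ r in Iic (0 : ℝ), (1 + |r|) ^ 2 * Real.exp (c * r)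
  have hJ : 0 ≤ J := integral_sq_mul_exp_nonneg c
  refine ⟨2 * (1 / μ * K * J), by positivity, fun t => ?_⟩
  rw [radiusSq, mul_assoc 2]
  gcongr
  have e : 1 / μ * K * J * (1 + |t|) ^ 2 = ∫ r in Iic (0 : ℝ),
      1 / μ * K * (1 + |t|) ^ 2 * ((1 + |r|) ^ 2 * Real.exp (c * r)) := by
    rw [integral_const_mul]; ring
  rw [e]
  refine setIntegral_mono_on (h.integrableOn_radiusIntegrand_one hμ hμlt x _)
    ((integrableOn_sq_mul_exp hc0).const_mul _) measurableSet_Iic fun r _ => ?_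
  rw [radiusIntegrand_one, shift_shift, ← hc]
  have h1 : 1 + |r + t| ≤ (1 + |r|) * (1 + |t|) := by
    nlinarith [abs_add_le r t, mul_nonneg (abs_nonneg r) (abs_nonneg t)]
  calc _ ≤ Real.exp (c * r) * (1 / μ * (K * ((1 + |r|) * (1 + |t|)) ^ 2)) := by
        gcongr
        exact (hle (r + t)).trans (by gcongr)
    _ = _ := by ring

theorem two_inner_fastField_le (h : IsDissipativePair A g lam L) (hμ : 0 < μ) (x : Vec n)
    (ω : PathSpace m η) (t : ℝ) (y : Vec m) :
    2 * inner ℝ y (fastField A g 1 x ω t y) ≤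
      -(lam - L - μ) * ‖y‖ ^ 2 + 2 * (1 / μ * radiusSource A g L x (shift t ω)) := by
  have hL := h.pos
  set z := ou A 1 (shift t ω) with hz
  have hfield : fastField A g 1 x ω t y = -A y + g x (y + z) := by
    simp [fastField, shiftEps, hz]
  have hg : ‖g x (y + z)‖ ≤ ‖g 0 0‖ + L * (‖x‖ + (‖y‖ + ‖z‖)) := by
    have h1 := h.lipschitz x 0 (y + z) 0
    rw [sub_zero, sub_zero] at h1
    have h2 := norm_sub_norm_le (g x (y + z)) (g 0 0)
    have h3 : L * (‖x‖ + ‖y + z‖) ≤ L * (‖x‖ + (‖y‖ + ‖z‖)) := by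
      gcongr; exact norm_add_le _ _
    linarith
  set b := ‖g 0 0‖ + L * ‖x‖ + L * ‖z‖ with hb
  have hinner : inner ℝ y (fastField A g 1 x ω t y) ≤ -(lam - L) * ‖y‖ ^ 2 + b * ‖y‖ := by
    rw [hfield, inner_add_right, inner_neg_right, real_inner_comm]
    have h1 := h.coercive y
    have h2 := (real_inner_le_norm y (g x (y + z))).trans
      (mul_le_mul_of_nonneg_left hg (norm_nonneg y))
    rw [hb]
    linarith
  -- The square of a sum of three terms is at most three times the sum of the squares, whence the
  -- factors 3 in the radius.
  have hbq : b ^ 2 ≤ radiusSource A g L x (shift t ω) := by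
    have h1 : ‖g 0 0‖ ^ 2 ≤ (max 1 L) ^ 2 * ‖g 0 0‖ ^ 2 :=
      le_mul_of_one_le_left (by positivity) (one_le_pow₀ (le_max_left _ _))
    rw [radiusSource, ← hz, hb]
    nlinarith [sq_nonneg (‖g 0 0‖ - L * ‖x‖), sq_nonneg (‖g 0 0‖ - L * ‖z‖),
      sq_nonneg (L * ‖x‖ - L * ‖z‖)]
  have hyoung : 2 * (b * ‖y‖) ≤ μ * ‖y‖ ^ 2 + 1 / μ * b ^ 2 := by
    have h1 : 0 ≤ 1 / μ * (μ * ‖y‖ - b) ^ 2 := by positivity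
    have h2 : 1 / μ * (μ * ‖y‖ - b) ^ 2 = μ * ‖y‖ ^ 2 + 1 / μ * b ^ 2 - 2 * (b * ‖y‖) := by
      field_simp
      ring
    linarith
  have hq : 1 / μ * b ^ 2 ≤ 1 / μ * radiusSource A g L x (shift t ω) := by gcongr
  -- The estimate has slack: a further `(lam - L) * ‖y‖ ^ 2` of dissipation and one of the two
  -- copies of the source are given away to match the prescribed radius.
  have hq0 : 0 ≤ 1 / μ * radiusSource A g L x (shift t ω) :=
    mul_nonneg (by positivity) (radiusSource_nonneg _ _ _ _ _)
  have hκ : 0 ≤ (lam - L) * ‖y‖ ^ 2 := mul_nonneg (sub_nonneg.2 h.lt.le) (sq_nonneg _)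
  linarith

theorem sq_norm_phiTilde_le (h : IsDissipativePair A g lam L) (hμ : 0 < μ) (hμlt : μ < lam - L)
    (x : Vec n) (t : ℝ≥0) {ω : PathSpace m η} {y : Vec m}
    (hy : ‖y‖ ^ 2 ≤ radiusSq A g lam L μ 1 x ω) :
    ‖phiTilde A g 1 x t ω y‖ ^ 2 ≤ radiusSq A g lam L μ 1 x (shift t ω) := by
  have hsol := h.isForwardSolution_phiTilde one_pos x ω y
  have hG : ∀ t, HasDerivAt (fun t => 2 * ∫ r in Iic t, radiusIntegrand A g lam L μ 1 x ω r)
      (Real.exp ((lam - L - μ) * t) * (2 * (1 / μ * radiusSource A g L x (shift t ω)))) t := by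
    intro t
    convert! (hasDerivAt_integral_Iic (h.continuous_radiusIntegrand x ω)
      (h.integrableOn_radiusIntegrand_one hμ hμlt x ω) t).const_mul 2 using 1
    rw [radiusIntegrand_one]
    ring
  have key := exp_mul_le_of_hasDerivWithinAt (a := lam - L - μ)
    (fun t ht => (hsol.2 t ht).norm_sq) hG
    (fun t _ => h.two_inner_fastField_le hμ x ω t _) t.2
  simp only [← exp_mul_radiusSq_shift, shift_zero, mul_zero, Real.exp_zero, one_mul,
    NNReal.val_eq_coe, Real.toNNReal_coe, Real.toNNReal_zero, h.phiTilde_zero one_pos] at key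
  refine le_of_mul_le_mul_left ?_ (Real.exp_pos ((lam - L - μ) * t))
  linarith

end IsDissipativePair

end Radius

/-! ### Invariant balls, the fixed point and its dependence on the parameter -/

namespace IsDissipativePair

variable {m n : ℕ} {η : ℝ} {A : Vec m →L[ℝ] Vec m} {g : Vec n → Vec m → Vec m} {lam L ε μ : ℝ}

theorem exists_norm_ou_add_radius_le (h : IsDissipativePair A g lam L) (hε : 0 < ε) (hμ : 0 < μ)
    (hμlt : μ < lam - L) (x : Vec n) (ω : PathSpace m η) :
    ∃ K : ℝ, ∀ t, ‖ou A ε (shiftEps ε t ω)‖ +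
      Real.sqrt (radiusSq A g lam L μ ε x (shiftEps ε t ω)) ≤ K * (1 + |t|) := by
  obtain ⟨K₁, hK₁, h₁⟩ := exists_norm_ou_shift_le h.coercive h.lam_pos ω
  obtain ⟨K₂, hK₂, h₂⟩ := h.exists_radiusSq_le hμ hμlt x ω
  refine ⟨(K₁ + Real.sqrt K₂) * (1 + 1 / ε), fun t => ?_⟩
  have ht : 1 + |t / ε| ≤ (1 + 1 / ε) * (1 + |t|) := by
    have : |t / ε| = 1 / ε * |t| := by rw [abs_div, abs_of_pos hε]; ring
    rw [this]
    have := one_div_pos.2 hε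
    nlinarith [abs_nonneg t]
  have hs : Real.sqrt (radiusSq A g lam L μ 1 x (shift (t / ε) ω)) ≤
      Real.sqrt K₂ * (1 + |t / ε|) := by
    rw [← Real.sqrt_sq (by positivity : 0 ≤ 1 + |t / ε|), ← Real.sqrt_mul hK₂]
    exact Real.sqrt_le_sqrt (h₂ _)
  rw [ou_shiftEps A hε, radiusSq_eq_one hε, shiftEps]
  calc _ ≤ K₁ * (1 + |t / ε|) + Real.sqrt K₂ * (1 + |t / ε|) := add_le_add (h₁ _) hs
    _ = (K₁ + Real.sqrt K₂) * (1 + |t / ε|) := by ring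
    _ ≤ (K₁ + Real.sqrt K₂) * ((1 + 1 / ε) * (1 + |t|)) := by gcongr
    _ = _ := by ring

theorem measurable_radius (hε : 0 < ε) (x : Vec n) :
    Measurable fun ω : PathSpace m η => Real.sqrt (radiusSq A g lam L μ ε x ω) := by
  simp only [radiusSq_eq_one hε]
  exact (measurable_radiusSq x).sqrt

theorem isTemperedRandomSet_ballCZ (h : IsDissipativePair A g lam L) (hε : 0 < ε) (hμ : 0 < μ)
    (hμlt : μ < lam - L) (x : Vec n) :
    IsTemperedRandomSet (shiftEps ε) (ballCZ (η := η) A g lam L μ ε x) :=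
  isTemperedRandomSet_closedBall (measurable_ou A ε) (measurable_radius hε x)
    (fun _ => Real.sqrt_nonneg _) (h.exists_norm_ou_add_radius_le hε hμ hμlt x)

theorem isTemperedRandomSet_ballC (h : IsDissipativePair A g lam L) (hε : 0 < ε) (hμ : 0 < μ)
    (hμlt : μ < lam - L) (x : Vec n) :
    IsTemperedRandomSet (shiftEps ε) (ballC (η := η) A g lam L μ ε x) := by
  refine isTemperedRandomSet_closedBall measurable_const (measurable_radius hε x)
    (fun _ => Real.sqrt_nonneg _) fun ω => ?_
  obtain ⟨K, hK⟩ := h.exists_norm_ou_add_radius_le hε hμ hμlt x ω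
  refine ⟨K, fun t => le_trans ?_ (hK t)⟩
  rw [norm_zero]
  gcongr
  exact norm_nonneg _

theorem mem_ballC_iff (hε : 0 < ε) {x : Vec n} {ω : PathSpace m η} {y : Vec m} :
    y ∈ ballC A g lam L μ ε x ω ↔ y ∈ ballC A g lam L μ 1 x ω := by
  rw [ballC, ballC, radiusSq_eq_one hε]

theorem mem_ballCZ_iff {x : Vec n} {ω : PathSpace m η} {y : Vec m} :
    y ∈ ballCZ A g lam L μ ε x ω ↔ y - ou A ε ω ∈ ballC A g lam L μ ε x ω := by
  rw [ballC, ballCZ, mem_closedBall_iff_norm, mem_closedBall_zero_iff]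

theorem zero_mem_ballC (x : Vec n) (ω : PathSpace m η) : 0 ∈ ballC A g lam L μ ε x ω :=
  Metric.mem_closedBall_self (Real.sqrt_nonneg _)

theorem phiTilde_one_mem_ballC (h : IsDissipativePair A g lam L) (hμ : 0 < μ)
    (hμlt : μ < lam - L) (x : Vec n) (t : ℝ≥0) {ω : PathSpace m η} {y : Vec m}
    (hy : y ∈ ballC A g lam L μ 1 x ω) :
    phiTilde A g 1 x t ω y ∈ ballC A g lam L μ 1 x (shift t ω) := by
  rw [ballC, mem_closedBall_zero_iff] at hy ⊢
  exact Real.le_sqrt_of_sq_le (h.sq_norm_phiTilde_le hμ hμlt x t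
    ((Real.le_sqrt (norm_nonneg _) (radiusSq_nonneg hμ x ω)).1 hy))

theorem isForwardInvariant_ballC (h : IsDissipativePair A g lam L) (hε : 0 < ε) (hμ : 0 < μ)
    (hμlt : μ < lam - L) (x : Vec n) :
    IsForwardInvariant (shiftEps ε) (phiTilde A g ε x) (ballC (η := η) A g lam L μ ε x) := by
  rintro t ω _ ⟨y, hy, rfl⟩
  rw [mem_ballC_iff hε] at hy ⊢
  have := h.phiTilde_one_mem_ballC hμ hμlt x (t / ε).toNNReal hy
  rwa [← h.phiTilde_eq_one hε, Real.coe_toNNReal _ (div_nonneg t.coe_nonneg hε.le)] at this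

theorem isForwardInvariant_ballCZ (h : IsDissipativePair A g lam L) (hε : 0 < ε) (hμ : 0 < μ)
    (hμlt : μ < lam - L) (x : Vec n) :
    IsForwardInvariant (shiftEps ε) (phi A g ε x) (ballCZ (η := η) A g lam L μ ε x) := by
  rintro t ω _ ⟨y, hy, rfl⟩
  rw [mem_ballCZ_iff] at hy ⊢
  have := h.isForwardInvariant_ballC hε hμ hμlt x t ω (mem_image_of_mem _ hy)
  simpa [phi, conj, conjInv] using this

/-- The pullback limit of the unscaled system is a random fixed point at every time scale. -/
theorem exists_randomFixedPoint (h : IsDissipativePair A g lam L) (x : Vec n)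
    {P : Measure (PathSpace m η)} (hP : IsMetricDS (shiftEps 1) P) :
    ∃ Y : PathSpace m η → Vec m,
      (∀ ε, 0 < ε → IsRandomFixedPoint (shiftEps ε) (phiTilde A g ε x) Y) ∧
      ∀ ω, Tendsto (fun k : ℕ => phiTilde A g 1 x k (shift (-(k : ℝ)) ω) 0) atTop (𝓝 (Y ω)) := by
  have hκ : 0 < (lam - L) / 1 := by rw [div_one]; exact sub_pos.2 h.lt
  -- Any admissible `μ` would do: the ball only supplies a tempered bound, and the pullback limit
  -- does not involve `μ`.
  have hμ : 0 < (lam - L) / 2 := half_pos (sub_pos.2 h.lt)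
  have hμlt : (lam - L) / 2 < lam - L := half_lt_self (sub_pos.2 h.lt)
  have hball := h.isTemperedRandomSet_ballC (η := η) one_pos hμ hμlt x
  obtain ⟨Y, hY, hlim⟩ := exists_randomFixedPoint_of_contraction
    (h.isRDS_phiTilde one_pos x hP) hκ (h.norm_phiTilde_sub_le one_pos x) hball.tempered
    fun t ω => hball.norm_le (h.isForwardInvariant_ballC one_pos hμ hμlt x t ω
      (mem_image_of_mem _ (zero_mem_ballC x ω)))
  refine ⟨Y, fun ε hε => ⟨hY.measurable, fun t ω => ?_⟩, fun ω => ?_⟩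
  · rw [h.phiTilde_eq_one hε, hY.fixed, Real.coe_toNNReal _ (div_nonneg t.coe_nonneg hε.le)]
    simp [shiftEps]
  · simpa [shiftEps] using hlim ω

/-- Both solutions start at the same point, and the bound is uniform in time and path, so it
survives the pullback limit. -/
theorem norm_phiTilde_param_sub_le (h : IsDissipativePair A g lam L) (x₁ x₂ : Vec n) (t : ℝ≥0)
    (ω : PathSpace m η) (y : Vec m) :
    ‖phiTilde A g 1 x₁ t ω y - phiTilde A g 1 x₂ t ω y‖ ≤ L / (lam - L) * ‖x₁ - x₂‖ := by
  have hκ : 0 < lam - L := sub_pos.2 h.lt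
  have hL := h.pos
  set κ := lam - L
  set c := κ * (L / κ * ‖x₁ - x₂‖) ^ 2 with hc
  have h₁ := h.isForwardSolution_phiTilde one_pos x₁ ω y
  have h₂ := h.isForwardSolution_phiTilde one_pos x₂ ω y
  have hG : ∀ t : ℝ, HasDerivAt (fun t => (L / κ * ‖x₁ - x₂‖) ^ 2 * Real.exp (κ * t))
      (Real.exp (κ * t) * c) t := by
    intro t
    convert! (((hasDerivAt_id t).const_mul κ).exp).const_mul ((L / κ * ‖x₁ - x₂‖) ^ 2) using 1
    simp only [id, hc]
    ring
  have key := exp_mul_le_of_hasDerivWithinAt (a := κ) (h := fun _ => c)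
    (fun t ht => ((h₁.2 t ht).sub (h₂.2 t ht)).norm_sq) hG (fun t _ => by
      have h3 := h.inner_fastField_sub_le one_pos x₁ x₂ ω t
        (phiTilde A g 1 x₁ t.toNNReal ω y) (phiTilde A g 1 x₂ t.toNNReal ω y)
      simp only [Pi.sub_apply, div_one] at h3 ⊢
      rw [real_inner_comm] at h3
      set d := ‖phiTilde A g 1 x₁ t.toNNReal ω y - phiTilde A g 1 x₂ t.toNNReal ω y‖
      -- Young's inequality spends half of the dissipation `2 * κ`; the constant source `c` is
      -- chosen so that the equilibrium of the comparison equation is the square of the claimed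
      -- bound.
      have h4 : 0 ≤ κ * (d - L / κ * ‖x₁ - x₂‖) ^ 2 := by positivity
      have h5 : κ * (d - L / κ * ‖x₁ - x₂‖) ^ 2 = κ * d ^ 2 - 2 * (L * ‖x₁ - x₂‖ * d) + c := by
        rw [hc]; field_simp; ring
      linarith) t.2
  simp only [Pi.sub_apply, NNReal.val_eq_coe, Real.toNNReal_coe, Real.toNNReal_zero,
    h.phiTilde_zero one_pos, sub_self, norm_zero, mul_zero, Real.exp_zero, mul_one] at key
  refine le_of_sq_le_sq ?_ (by positivity)
  refine le_of_mul_le_mul_left ?_ (Real.exp_pos (κ * t))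
  nlinarith [sq_nonneg (L / κ * ‖x₁ - x₂‖)]

end IsDissipativePair

end FastSlow

/-! ### Assembly of the theorem -/

theorem mainTheorem2 {m n : ℕ} (H η : ℝ) (hH : H ∈ Set.Ioc (1 / 3 : ℝ) (1 / 2))
    (hη : η ∈ Set.Ioo (1 / 3 : ℝ) H)
    (P : Measure (FastSlow.PathSpace m η)) [IsProbabilityMeasure P]
    (hP : FastSlow.IsFBMLaw H P)
    (A : FastSlow.Vec m →L[ℝ] FastSlow.Vec m)
    (g : FastSlow.Vec n → FastSlow.Vec m → FastSlow.Vec m) (lam L : ℝ)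
    (hA : ∀ y, lam * ‖y‖ ^ 2 ≤ inner ℝ (A y) y)
    (hL : 0 < L) (hlam : L < lam)
    (hg : ∀ x₁ x₂ y₁ y₂, ‖g x₁ y₁ - g x₂ y₂‖ ≤ L * (‖x₁ - x₂‖ + ‖y₁ - y₂‖)) :
    -- the stationary Ornstein-Uhlenbeck process
    (∀ ε : ℝ, 0 < ε →
      Measurable (fun ω : FastSlow.PathSpace m η => FastSlow.ou A ε ω) ∧
      ∀ ω : FastSlow.PathSpace m η,
        IntegrableOn (FastSlow.ouIntegrand A ε ω) (Set.Iic 0) ∧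
        Continuous (fun t : ℝ => FastSlow.ou A ε (FastSlow.shiftEps ε t ω)) ∧
        (∀ s t : ℝ,
          FastSlow.ou A ε (FastSlow.shiftEps ε t ω)
            = FastSlow.ou A ε (FastSlow.shiftEps ε s ω)
              - (1 / ε) • (∫ r in s..t, A (FastSlow.ou A ε (FastSlow.shiftEps ε r ω)))
              + (FastSlow.driver ε ω t - FastSlow.driver ε ω s)) ∧
        (∀ t : ℝ, FastSlow.ou A ε (FastSlow.shiftEps ε t ω)
          = FastSlow.ou A 1 (FastSlow.shift (t / ε) ω))) ∧
    -- the two conjugated random dynamical systems, generated by the two equations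
    (∀ ε : ℝ, 0 < ε → ∀ x : FastSlow.Vec n,
      (∀ (ω : FastSlow.PathSpace m η) (y₀ : FastSlow.Vec m),
        FastSlow.IsTransformedSolution A g ε x ω y₀
          (fun t => FastSlow.phiTilde A g ε x t.toNNReal ω y₀) ∧
        (∀ u, FastSlow.IsTransformedSolution A g ε x ω y₀ u →
          Set.EqOn u (fun t => FastSlow.phiTilde A g ε x t.toNNReal ω y₀) (Set.Ici 0)) ∧
        FastSlow.IsFastSolution A g ε x ω y₀
          (fun t => FastSlow.phi A g ε x t.toNNReal ω y₀) ∧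
        (∀ u, FastSlow.IsFastSolution A g ε x ω y₀ u →
          Set.EqOn u (fun t => FastSlow.phi A g ε x t.toNNReal ω y₀) (Set.Ici 0))) ∧
      FastSlow.IsRDS (FastSlow.shiftEps ε) P (FastSlow.phiTilde A g ε x) ∧
      FastSlow.IsRDS (FastSlow.shiftEps ε) P (FastSlow.phi A g ε x) ∧
      -- contraction on the whole space, uniformly in `x` and `ω`
      (∀ (t : NNReal) (ω : FastSlow.PathSpace m η) (y₁ y₂ : FastSlow.Vec m),
        ‖FastSlow.phiTilde A g ε x t ω y₁ - FastSlow.phiTilde A g ε x t ω y₂‖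
            ≤ Real.exp (-(lam - L) / ε * t) * ‖y₁ - y₂‖ ∧
        ‖FastSlow.phi A g ε x t ω y₁ - FastSlow.phi A g ε x t ω y₂‖
            ≤ Real.exp (-(lam - L) / ε * t) * ‖y₁ - y₂‖) ∧
      -- the square radius is finite and does not depend on `ε`
      (∀ μ : ℝ, 0 < μ → μ < lam - L → ∀ ω : FastSlow.PathSpace m η,
        IntegrableOn (FastSlow.radiusIntegrand A g lam L μ ε x ω) (Set.Iic 0) ∧
        FastSlow.radiusSq A g lam L μ ε x ω = FastSlow.radiusSq A g lam L μ 1 x ω)) ∧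
    -- the random fixed points `Yt` of `phiTilde` and `Yt + Z` of `phi`
    ∃ Yt Y : ℝ → FastSlow.Vec n → FastSlow.PathSpace m η → FastSlow.Vec m,
      (∀ ε x ω, Y ε x ω = Yt ε x ω + FastSlow.ou A ε ω) ∧
      ∀ ε : ℝ, 0 < ε →
        (∀ x : FastSlow.Vec n, ∀ μ : ℝ, 0 < μ → μ < lam - L →
          FastSlow.IsAttractingFixedPointIn (FastSlow.shiftEps ε) P
            (FastSlow.phiTilde A g ε x) ((lam - L) / ε)
            (FastSlow.ballC A g lam L μ ε x) (Yt ε x) ∧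
          FastSlow.IsAttractingFixedPointIn (FastSlow.shiftEps ε) P
            (FastSlow.phi A g ε x) ((lam - L) / ε)
            (FastSlow.ballCZ A g lam L μ ε x) (Y ε x)) ∧
        (∀ (x : FastSlow.Vec n) (t : ℝ) (ω : FastSlow.PathSpace m η),
          Yt ε x (FastSlow.shiftEps ε t ω) = Yt 1 x (FastSlow.shift (t / ε) ω) ∧
          Y ε x (FastSlow.shiftEps ε t ω) = Y 1 x (FastSlow.shift (t / ε) ω)) ∧
        (∀ (x₁ x₂ : FastSlow.Vec n) (ω : FastSlow.PathSpace m η),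
          ‖Yt ε x₁ ω - Yt ε x₂ ω‖ ≤ L / (lam - L) * ‖x₁ - x₂‖ ∧
          ‖Y ε x₁ ω - Y ε x₂ ω‖ ≤ L / (lam - L) * ‖x₁ - x₂‖) := by
  have h : FastSlow.IsDissipativePair A g lam L := ⟨hA, hL, hlam, hg⟩
  have hDS : ∀ ε, FastSlow.IsMetricDS (FastSlow.shiftEps ε) P :=
    FastSlow.isMetricDS_shiftEps (lt_trans (by norm_num) hH.1) hP
  refine ⟨fun ε hε => ⟨FastSlow.measurable_ou A ε, fun ω =>
    ⟨FastSlow.integrableOn_ouIntegrand hA h.lam_pos hε ω,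
      FastSlow.continuous_ou_shiftEps hA h.lam_pos hε ω,
      FastSlow.ou_shiftEps_sub hA h.lam_pos hε ω,
      FastSlow.ou_shiftEps A hε ω⟩⟩, fun ε hε x => ⟨fun ω y₀ => ?_,
    h.isRDS_phiTilde hε x (hDS ε), h.isRDS_phi hε x (hDS ε), fun t ω y₁ y₂ => ?_,
    fun μ hμ hμlt ω => ⟨h.integrableOn_radiusIntegrand hε hμ hμlt x ω,
      FastSlow.radiusSq_eq_one hε x ω⟩⟩, ?_⟩
  · refine ⟨h.phiTilde_spec hε x ω y₀, fun u hu t ht => ?_, h.phi_spec hε x ω y₀,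
      fun u hu => h.eqOn_phi hε hu⟩
    have := h.eq_phiTilde hε hu t.toNNReal
    rwa [Real.coe_toNNReal _ ht] at this
  · rw [neg_div]
    exact ⟨h.norm_phiTilde_sub_le hε x t ω y₁ y₂, h.norm_phi_sub_le hε x t ω y₁ y₂⟩
  · choose Y hY hlim using fun x => h.exists_randomFixedPoint x (hDS 1)
    have hmem : ∀ ε, 0 < ε → ∀ x μ, 0 < μ → μ < lam - L → ∀ ω,
        Y x ω ∈ FastSlow.ballC A g lam L μ ε x ω := by
      intro ε hε x μ hμ hμlt ω
      rw [FastSlow.IsDissipativePair.mem_ballC_iff hε]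
      -- The centre `0` lies in the ball of every `μ`, so invariance keeps all pullbacks in it, and
      -- the ball is closed.
      refine Metric.isClosed_closedBall.mem_of_tendsto (hlim x ω) (Eventually.of_forall fun k => ?_)
      have := h.phiTilde_one_mem_ballC hμ hμlt x k
        (FastSlow.IsDissipativePair.zero_mem_ballC x (FastSlow.shift (-(k : ℝ)) ω))
      rwa [NNReal.coe_natCast, FastSlow.shift_shift, add_neg_cancel, FastSlow.shift_zero] at this
    have hlip : ∀ x₁ x₂ ω, ‖Y x₁ ω - Y x₂ ω‖ ≤ L / (lam - L) * ‖x₁ - x₂‖ := fun x₁ x₂ ω =>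
      le_of_tendsto ((hlim x₁ ω).sub (hlim x₂ ω)).norm
        (Eventually.of_forall fun k => h.norm_phiTilde_param_sub_le x₁ x₂ k _ 0)
    -- The family is constant in `ε`, so the scaling relation for the first fixed point is
    -- definitional; for the second it reduces to that of `ou`.
    refine ⟨fun _ => Y, fun ε x ω => Y x ω + FastSlow.ou A ε ω, fun _ _ _ => rfl,
      fun ε hε => ⟨fun x μ hμ hμlt => ⟨?_, ?_⟩, fun x t ω => ⟨rfl, ?_⟩,
        fun x₁ x₂ ω => ⟨hlip x₁ x₂ ω, ?_⟩⟩⟩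
    · exact FastSlow.isAttractingFixedPointIn_of_contraction (h.isRDS_phiTilde hε x (hDS ε))
        (div_pos (sub_pos.2 hlam) hε) (h.norm_phiTilde_sub_le hε x)
        (h.isTemperedRandomSet_ballC hε hμ hμlt x) (h.isForwardInvariant_ballC hε hμ hμlt x)
        (hY x ε hε) (hmem ε hε x μ hμ hμlt)
    · refine FastSlow.isAttractingFixedPointIn_of_contraction (h.isRDS_phi hε x (hDS ε))
        (div_pos (sub_pos.2 hlam) hε) (h.norm_phi_sub_le hε x)
        (h.isTemperedRandomSet_ballCZ hε hμ hμlt x) (h.isForwardInvariant_ballCZ hε hμ hμlt x)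
        ⟨(hY x ε hε).measurable.add (FastSlow.measurable_ou A ε), fun t ω => ?_⟩ fun ω => ?_
      · rw [FastSlow.phi, FastSlow.conjInv, add_sub_cancel_right, (hY x ε hε).fixed,
          FastSlow.conj]
      · rw [FastSlow.IsDissipativePair.mem_ballCZ_iff, add_sub_cancel_right]
        exact hmem ε hε x μ hμ hμlt ω
    · beta_reduce
      rw [FastSlow.ou_shiftEps A hε, FastSlow.shiftEps]
    · rw [add_sub_add_right_eq_sub]
      exact hlip x₁ x₂ ω
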